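/- Let $n>k\ge 2$ be integers, and let $\Sigma_n$ be the symmetric group on $[n]=\{1,\dots,n\}$. Let $\Pi_n$ be the lattice of set partitions of $[n]$, ordered so that the partition into singletons is the least element $\hat 0$ and the one-block partition is the greatest element $\hat 1$. The $k$-equal lattice $\Pi_{n,k}$ is the subposet of $\Pi_n$ consisting of all joins (including the empty join $\hat 0$) of partitions having a single nontrivial block, of size $k$. Its homology is the homology of the order complex $\Delta(\Pi_{n,k})$ of its proper part $\Pi_{n,k}\setminus\{\hat 0,\hat 1\}$. Consider finite rooted trees with $n$ leaves labelled by $1,\dots,n$, in which every non-leaf (including the root) has at least two children, up to root- and label-preserving isomorphism (combinatorial types). A preleaf is a non-leaf all of whose children are leaves; an internal edge is an edge not adjacent to a leaf. The complex of $k$-equal trees $T_{n,k}$ is the simplicial complex whose maximal simplices are the combinatorial types of those trees in which every preleaf has exactly $k$ children and every other non-leaf has exactly two children; the faces of the simplex of a tree $T$ are obtained by contracting internal edges of $T$. (Thus the vertices of the simplex of $T$ are the combinatorial types of the trees obtained from $T$ by contracting all internal edges but one.) The group $\Sigma_n$ acts on $T_{n,k}$ by permuting the leaf labels and on $\Pi_{n,k}$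 by permuting the elements of $[n]$. Then, for every commutative ring $R$ of coefficients (in particular $R=\mathbb{Z}$), the reduced homology groups of $T_{n,k}$ and of $\Pi_{n,k}$ are isomorphic as graded $\Sigma_n$-modules: in every degree $i$ there is an $R$-linear $\Sigma_n$-equivariant isomorphism \[ \widetilde H_i(T_{n,k};R)\;\cong_{\Sigma_n}\;\widetilde H_i(\Pi_{n,k};R). \] -/

import Mathlib

/-! ### Reduced simplicial homology as a representation -/

namespace SimplicialHomology

noncomputable section

/-- The subquotient `Z / B` of a module `M`, for submodules `B ≤ Z` (in general, `Z / (Z ∩ B)`). -/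
abbrev Subquotient {R M : Type*} [CommRing R] [AddCommGroup M] [Module R M]
    (Z B : Submodule R M) : Type _ :=
  Z ⧸ B.submoduleOf Z

/-- The representation induced on a subquotient by two invariant submodules. -/
def subquotientRep {R M G : Type*} [CommRing R] [AddCommGroup M] [Module R M] [Group G]
    (ρ : Representation R G M) (Z B : Submodule R M)
    (hZ : ∀ g, Z ≤ Z.comap (ρ g)) (hB : ∀ g, B ≤ B.comap (ρ g)) :
    Representation R G (Subquotient Z B) :=
  (ρ.subrepresentation Z hZ).quotient (B.submoduleOf Z) fun g _ hc => hB g hc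

/-- The alternating sum of the faces of a `(d+1)`-tuple of vertices, extended linearly. For `d = 0`
it sends every `1`-tuple to the empty tuple, i.e. it is the augmentation. -/
def boundary (R : Type*) [CommRing R] (V : Type*) (d : ℕ) :
    ((Fin (d + 1) → V) →₀ R) →ₗ[R] ((Fin d → V) →₀ R) :=
  Finsupp.linearCombination R fun t : Fin (d + 1) → V =>
    ∑ i : Fin (d + 1), (-1 : R) ^ (i : ℕ) • Finsupp.single (fun j => t (i.succAbove j)) (1 : R)

/-- The augmented ordered chains of a simplicial complex `K` in degree `d - 1`: the free module on
the `d`-tuples of vertices (repetitions allowed) that span a face of `K`; the empty tuple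
(the case `d = 0`) is always allowed, as it is the generator in degree `-1`. -/
def chains (R : Type*) [CommRing R] {V : Type*} (K : PreAbstractSimplicialComplex V) (d : ℕ) :
    Submodule R ((Fin d → V) →₀ R) :=
  Finsupp.supported R R
    {t | Set.range t = ∅ ∨ ∃ s ∈ K.faces, (s : Set V) = Set.range t}

/-- The cycles in degree `d - 1` of the augmented ordered chain complex. -/
def cycles (R : Type*) [CommRing R] {V : Type*} (K : PreAbstractSimplicialComplex V) :
    (d : ℕ) → Submodule R ((Fin d → V) →₀ R)
  | 0 => chains R K 0
  | d + 1 => chains R K (d + 1) ⊓ LinearMap.ker (boundary R V d)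

/-- The boundaries in degree `d - 1` of the augmented ordered chain complex. -/
def boundaries (R : Type*) [CommRing R] {V : Type*} (K : PreAbstractSimplicialComplex V) (d : ℕ) :
    Submodule R ((Fin d → V) →₀ R) :=
  (chains R K (d + 1)).map (boundary R V d)

/-- The reduced simplicial homology of `K` with coefficients in `R`, **in degree `d - 1`**
(so `d = 0` is degree `-1`, the lowest degree in which reduced homology can be nonzero). -/
abbrev ReducedHomology (R : Type*) [CommRing R] {V : Type*} (K : PreAbstractSimplicialComplex V)
    (d : ℕ) : Type _ :=
  Subquotient (cycles R K d) (boundaries R K d)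

/-- A simplicial complex is invariant under a group acting on its vertices. -/
def IsInvariant (G : Type*) [Group G] {V : Type*} [MulAction G V]
    (K : PreAbstractSimplicialComplex V) : Prop :=
  ∀ g : G, ∀ s ∈ K.faces, s.map (MulAction.toPerm g).toEmbedding ∈ K.faces

variable (R : Type*) [CommRing R] (G : Type*) [Group G] {V : Type*} [MulAction G V]

/-- The action of `G` on linear combinations of tuples, given by acting on all vertices. -/
def tupleRep (V : Type*) [MulAction G V] (d : ℕ) :
    Representation R G ((Fin d → V) →₀ R) where
  toFun g := Finsupp.lmapDomain R R (g • ·)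
  map_one' := by ext; simp
  map_mul' x y := by ext; simp [mul_smul]

variable {G}

theorem tupleRep_single {d : ℕ} (g : G) (t : Fin d → V) (r : R) :
    tupleRep R G V d g (Finsupp.single t r) = Finsupp.single (g • t) r := by
  simp [tupleRep]

theorem boundary_tupleRep {d : ℕ} (g : G) (c : (Fin (d + 1) → V) →₀ R) :
    boundary R V d (tupleRep R G V (d + 1) g c) = tupleRep R G V d g (boundary R V d c) := by
  suffices h : boundary R V d ∘ₗ tupleRep R G V (d + 1) g = tupleRep R G V d g ∘ₗ boundary R V d by
    exact LinearMap.congr_fun h c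
  refine Finsupp.lhom_ext fun t r => ?_
  simp only [LinearMap.comp_apply, tupleRep_single, boundary, Finsupp.linearCombination_single,
    map_smul, map_sum]
  rfl

variable {R} {K : PreAbstractSimplicialComplex V}

theorem chains_le_comap (hK : IsInvariant G K) (d : ℕ) (g : G) :
    chains R K d ≤ (chains R K d).comap (tupleRep R G V d g) := by
  rw [chains, Finsupp.supported_eq_span_single, Submodule.span_le]
  rintro _ ⟨t, ht, rfl⟩
  simp only [Submodule.comap_coe, Set.mem_preimage, tupleRep_single, SetLike.mem_coe]
  refine Submodule.subset_span ⟨g • t, ?_, rfl⟩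
  have hr : Set.range (g • t) = (g • ·) '' Set.range t := by
    rw [← Set.range_comp]; rfl
  rcases ht with ht | ⟨s, hs, hst⟩
  · left; rw [hr, ht, Set.image_empty]
  · right
    refine ⟨_, hK g s hs, ?_⟩
    rw [hr, ← hst]
    simp

theorem cycles_le_comap (hK : IsInvariant G K) (d : ℕ) (g : G) :
    cycles R K d ≤ (cycles R K d).comap (tupleRep R G V d g) := by
  cases d with
  | zero => exact chains_le_comap hK 0 g
  | succ d =>
    intro c hc
    refine ⟨chains_le_comap hK _ g hc.1, ?_⟩
    have h := hc.2
    simp only [SetLike.mem_coe, LinearMap.mem_ker] at h ⊢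
    rw [boundary_tupleRep, h, map_zero]

theorem boundaries_le_comap (hK : IsInvariant G K) (d : ℕ) (g : G) :
    boundaries R K d ≤ (boundaries R K d).comap (tupleRep R G V d g) := by
  rintro _ ⟨c, hc, rfl⟩
  exact ⟨_, chains_le_comap hK _ g hc, boundary_tupleRep R g c⟩

variable (R) (K)

/-- The representation of `G` on the reduced homology, in degree `d - 1`, of a `G`-invariant
simplicial complex: it is induced by the action of `G` on the vertices. -/
def reducedHomologyRep (hK : IsInvariant G K) (d : ℕ) :
    Representation R G (ReducedHomology R K d) :=
  subquotientRep (tupleRep R G V d) (cycles R K d) (boundaries R K d) (cycles_le_comap hK d)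
    (boundaries_le_comap hK d)

end

end SimplicialHomology

/-! ### The `k`-equal lattice -/

namespace KEqualLattice

/-- The order complex of a subset `S` of a poset: its faces are the nonempty finite chains
contained in `S`. -/
def orderComplex {P : Type*} [PartialOrder P] (S : Set P) : PreAbstractSimplicialComplex P where
  faces := {c | c.Nonempty ∧ (c : Set P) ⊆ S ∧ IsChain (· ≤ ·) (c : Set P)}
  isRelLowerSet_faces := fun _ hc =>
    ⟨hc.1, fun _ hb hne => ⟨hne, (Finset.coe_subset.2 hb).trans hc.2.1,
      hc.2.2.mono (Finset.coe_subset.2 hb)⟩⟩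

/-- The set partition `π` of `{1, …, n}` has exactly one nontrivial block, if `2 ≤ k`, and that
block has `k` elements. Set partitions are equivalence relations, and `π ≤ ρ` means that
`π` refines `ρ`, so `⊥` is the partition into singletons and `⊤` the one-block partition. -/
def IsSingleBlock {n : ℕ} (k : ℕ) (π : Setoid (Fin n)) : Prop :=
  ∃ B : Finset (Fin n), B.card = k ∧ ∀ x y, π x y ↔ x = y ∨ (x ∈ B ∧ y ∈ B)

/-- The `k`-equal lattice `Π_{n,k}`, as a subposet of the partition lattice: all joins (including
the empty join `⊥`) of partitions with a single nontrivial block, of size `k`. -/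
def kEqualLattice (n k : ℕ) : Set (Setoid (Fin n)) :=
  {π | ∃ A : Set (Setoid (Fin n)), (∀ ρ ∈ A, IsSingleBlock k ρ) ∧ sSup A = π}

/-- The proper part of the `k`-equal lattice: its least element is `⊥` and, for `2 ≤ k ≤ n`, its
greatest element is `⊤`. -/
def properPart (n k : ℕ) : Set (Setoid (Fin n)) :=
  {π | π ∈ kEqualLattice n k ∧ π ≠ ⊥ ∧ π ≠ ⊤}

/-- The symmetric group acts on set partitions: the blocks of `σ • π` are the images under `σ` of
the blocks of `π`. -/
instance permAction (n : ℕ) : MulAction (Equiv.Perm (Fin n)) (Setoid (Fin n)) where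
  smul σ π := Setoid.comap (fun x => σ⁻¹ x) π
  one_smul π := by
    ext x y
    exact Iff.rfl
  mul_smul σ τ π := by
    ext x y
    change π ((σ * τ)⁻¹ x) ((σ * τ)⁻¹ y) ↔ π (τ⁻¹ (σ⁻¹ x)) (τ⁻¹ (σ⁻¹ y))
    rw [mul_inv_rev]
    rfl

theorem smul_rel {n : ℕ} (σ : Equiv.Perm (Fin n)) (π : Setoid (Fin n)) (x y : Fin n) :
    (σ • π) x y ↔ π (σ⁻¹ x) (σ⁻¹ y) := Iff.rfl

theorem smul_mono {n : ℕ} (σ : Equiv.Perm (Fin n)) {π ρ : Setoid (Fin n)} (h : π ≤ ρ) :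
    σ • π ≤ σ • ρ := fun {_ _} hxy => h hxy

theorem smul_le_iff {n : ℕ} (σ : Equiv.Perm (Fin n)) {π ρ : Setoid (Fin n)} :
    σ • π ≤ ρ ↔ π ≤ σ⁻¹ • ρ :=
  ⟨fun h => by simpa using smul_mono σ⁻¹ h, fun h => by simpa using smul_mono σ h⟩

theorem smul_bot {n : ℕ} (σ : Equiv.Perm (Fin n)) : σ • (⊥ : Setoid (Fin n)) = ⊥ :=
  le_antisymm ((smul_le_iff σ).2 bot_le) bot_le

theorem smul_top {n : ℕ} (σ : Equiv.Perm (Fin n)) : σ • (⊤ : Setoid (Fin n)) = ⊤ :=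
  top_le_iff.1 (by simpa using (smul_le_iff σ⁻¹ (π := ⊤) (ρ := ⊤)).1 le_top)

theorem IsSingleBlock.smul {n k : ℕ} (σ : Equiv.Perm (Fin n)) {π : Setoid (Fin n)}
    (h : IsSingleBlock k π) : IsSingleBlock k (σ • π) := by
  obtain ⟨B, hB, h⟩ := h
  refine ⟨B.map σ.toEmbedding, by simpa using hB, fun x y => ?_⟩
  rw [smul_rel, h]
  simp [Finset.mem_map_equiv, Equiv.Perm.inv_def]

theorem smul_mem_properPart {n k : ℕ} (σ : Equiv.Perm (Fin n)) {π : Setoid (Fin n)}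
    (h : π ∈ properPart n k) : σ • π ∈ properPart n k := by
  obtain ⟨⟨A, hA, rfl⟩, hb, ht⟩ := h
  refine ⟨⟨(σ • ·) '' A, ?_, ?_⟩, ?_, ?_⟩
  · rintro _ ⟨ρ, hρ, rfl⟩
    exact (hA ρ hρ).smul σ
  · refine le_antisymm (sSup_le ?_) ((smul_le_iff σ).2 (sSup_le fun ρ hρ => ?_))
    · rintro _ ⟨ρ, hρ, rfl⟩
      exact smul_mono σ (le_sSup hρ)
    · exact (smul_le_iff σ).1 (le_sSup ⟨ρ, hρ, rfl⟩)
  · intro h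
    exact hb (by rw [← smul_bot σ] at h; exact MulAction.injective σ h)
  · intro h
    exact ht (by rw [← smul_top σ] at h; exact MulAction.injective σ h)

theorem orderComplex_isInvariant (n k : ℕ) :
    SimplicialHomology.IsInvariant (Equiv.Perm (Fin n)) (orderComplex (properPart n k)) := by
  rintro σ s ⟨hne, hs, hc⟩
  refine ⟨by simpa using hne, ?_, ?_⟩
  · intro π hπ
    simp only [Finset.coe_map, Set.mem_image] at hπ
    obtain ⟨ρ, hρ, rfl⟩ := hπ
    exact smul_mem_properPart σ (hs hρ)
  · rw [Finset.coe_map]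
    rintro _ ⟨π, hπ, rfl⟩ _ ⟨ρ, hρ, rfl⟩ _
    rcases hc.total hπ hρ with h | h
    · exact Or.inl (smul_mono σ h)
    · exact Or.inr (smul_mono σ h)

end KEqualLattice

/-! ### The complex of `k`-equal trees -/

namespace KEqualTree

/-- A finite rooted tree with `n` leaves labelled bijectively by `Fin n`, in which all non-leaves
(among them the root) have outdegree at least `2`. In Mathlib's `RootedTree`, the order is the
ancestor order: the root is `⊥`, the parent of `v` is `Order.pred v`, the children of `v` are the
`w` with `v ⋖ w`, and the leaves are the maximal elements. -/
structure LabelledTree (n : ℕ) where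
  tree : RootedTree.{0}
  finite : Finite tree
  leaf : Fin n ≃ {v : tree // IsMax v}
  root_not_leaf : ¬ IsMax (⊥ : tree)
  two_le_outdegree : ∀ v : tree, ¬ IsMax v → 2 ≤ {w : tree | v ⋖ w}.ncard

namespace LabelledTree

variable {n : ℕ}

/-- Two labelled rooted trees have the same combinatorial type: there is an isomorphism of rooted
trees that preserves the labels of the leaves. -/
def SameType (T S : LabelledTree n) : Prop :=
  ∃ e : T.tree ≃o S.tree, ∀ i, e (T.leaf i) = S.leaf i

instance typeSetoid (n : ℕ) : Setoid (LabelledTree n) where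
  r := SameType
  iseqv :=
    { refl := fun _ => ⟨OrderIso.refl _, fun _ => rfl⟩
      symm := fun ⟨e, he⟩ => ⟨e.symm, fun i => by rw [← he i]; simp⟩
      trans := fun ⟨e, he⟩ ⟨f, hf⟩ => ⟨e.trans f, fun i => by simp [he, hf]⟩ }

/-- The internal edges (those not adjacent to a leaf), an edge being named by its end farther from
the root: `v` stands for the edge between `v` and its parent. -/
def internalEdges (T : LabelledTree n) : Set T.tree :=
  {v | v ≠ ⊥ ∧ ¬ IsMax v}

/-- The map `f` from the vertices of `T` to the vertices of `S` exhibits `S` as obtained from `T` by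
contracting a set of internal edges (namely those `v` with `f (pred v) = f v`). -/
structure IsContractionMap (T S : LabelledTree n) (f : T.tree → S.tree) : Prop where
  surjective : Function.Surjective f
  map_root : f ⊥ = ⊥
  map_leaf : ∀ i, f (T.leaf i) = S.leaf i
  /-- Every edge of `T` is contracted to a point or mapped to an edge of `S`. -/
  edge : ∀ v, v ≠ ⊥ → f (Order.pred v) = f v ∨ f (Order.pred v) ⋖ f v
  /-- The edges adjacent to leaves are not contracted. -/
  leaf_edge : ∀ i, f (Order.pred (T.leaf i : T.tree)) ≠ f (T.leaf i)
  /-- The fibres of `f` are connected: with `u` and `v`, a fibre contains the vertex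
  of the path from `u` to `v` that is closest to the root. -/
  connected : ∀ u v, f u = f v → f (u ⊓ v) = f u

/-- `S` is obtained from `T` by contracting a (possibly empty) set of internal edges. -/
def ContractsTo (T S : LabelledTree n) : Prop :=
  ∃ f : T.tree → S.tree, IsContractionMap T S f

/-- A preleaf is a leaf of the rooted tree that remains after removing all leaves: a vertex that
is not a leaf and has no descendants other than leaves. -/
def IsPreleaf (T : LabelledTree n) (v : T.tree) : Prop :=
  Maximal (fun w : T.tree => ¬ IsMax w) v

/-- The tree is binary except at preleaves, where it is `k`-ary. -/
def IsKEqual (k : ℕ) (T : LabelledTree n) : Prop :=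
  ∀ v : T.tree, ¬ IsMax v →
    (T.IsPreleaf v → {w : T.tree | v ⋖ w}.ncard = k) ∧
    (¬ T.IsPreleaf v → {w : T.tree | v ⋖ w}.ncard = 2)

/-- Relabelling the leaves: the leaf with label `i` gets the label `σ i`. -/
def relabel (σ : Equiv.Perm (Fin n)) (T : LabelledTree n) : LabelledTree n :=
  { T with leaf := σ.symm.trans T.leaf }

theorem SameType.relabel (σ : Equiv.Perm (Fin n)) {T S : LabelledTree n} (h : SameType T S) :
    SameType (T.relabel σ) (S.relabel σ) := by
  obtain ⟨e, he⟩ := h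
  exact ⟨e, fun i => he (σ.symm i)⟩

theorem ContractsTo.relabel (σ : Equiv.Perm (Fin n)) {T S : LabelledTree n} (h : ContractsTo T S) :
    ContractsTo (T.relabel σ) (S.relabel σ) := by
  obtain ⟨f, hf⟩ := h
  exact ⟨f, hf.surjective, hf.map_root, fun i => hf.map_leaf (σ.symm i), hf.edge,
    fun i => hf.leaf_edge (σ.symm i), hf.connected⟩

end LabelledTree

open LabelledTree

/-- Combinatorial types of rooted trees with `n` labelled leaves. -/
abbrev TreeType (n : ℕ) : Type 1 := Quotient (LabelledTree.typeSetoid n)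

/-- The simplex of `T`. Its vertices correspond to the internal edges of `T`: they are the
combinatorial types of the trees with exactly one internal edge that are obtained from `T` by
contracting all but one of its internal edges. -/
def simplex {n : ℕ} (T : LabelledTree n) : Set (TreeType n) :=
  {c | ∃ S : LabelledTree n, c = Quotient.mk _ S ∧ S.internalEdges.ncard = 1 ∧ T.ContractsTo S}

/-- The complex of `k`-equal trees `T_{n,k}`: the simplicial complex generated by the simplices of
the trees that are binary except at preleaves, where they are `k`-ary. Passing to the face
of the simplex of `T` on some of the internal edges of `T` amounts to contracting the other
internal edges of `T`. -/
def kEqualTreeComplex (n k : ℕ) : PreAbstractSimplicialComplex (TreeType n) where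
  faces := {s | s.Nonempty ∧
    ∃ T : LabelledTree n, T.IsKEqual k ∧ (s : Set (TreeType n)) ⊆ simplex T}
  isRelLowerSet_faces := fun _ hs =>
    ⟨hs.1, fun _ hb hne => ⟨hne, hs.2.choose, hs.2.choose_spec.1,
      (Finset.coe_subset.2 hb).trans hs.2.choose_spec.2⟩⟩

/-- The symmetric group acts on combinatorial types of trees by permuting the labels. -/
instance permAction (n : ℕ) : MulAction (Equiv.Perm (Fin n)) (TreeType n) where
  smul σ := Quotient.map (LabelledTree.relabel σ) fun _ _ h => SameType.relabel σ h
  one_smul c := by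
    induction c using Quotient.inductionOn with
    | h T => rfl
  mul_smul σ τ c := by
    induction c using Quotient.inductionOn with
    | h T => rfl

theorem kEqualTreeComplex_isInvariant (n k : ℕ) :
    SimplicialHomology.IsInvariant (Equiv.Perm (Fin n)) (kEqualTreeComplex n k) := by
  rintro σ s ⟨hne, T, hT, hs⟩
  refine ⟨by simpa using hne, T.relabel σ, hT, ?_⟩
  intro c hc
  simp only [Finset.coe_map, Set.mem_image] at hc
  obtain ⟨b, hb, rfl⟩ := hc
  obtain ⟨S, rfl, hS, hTS⟩ := hs hb
  exact ⟨S.relabel σ, rfl, hS, hTS.relabel σ⟩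

end KEqualTree

/-!
A tree type with one internal edge amounts to the cluster below that edge, a proper subset of
`{1, …, n}`. The faces of `T_{n,k}` are the laminar families of proper subsets with at least `k`
elements, because a maximal laminar family of this kind consists of the clusters of the internal
edges of a `k`-equal tree.

Label each vertex with the partition whose only nontrivial block is its cluster. The join of the
labels of a nonempty face lies in the proper part of `Π_{n,k}`. Conversely, for `π` in the proper
part, the faces with labels at most `π` form a cone, whose apex is a block of `π` with at least `k`
elements. The order complex, labelled by the identity, has the same two properties. By acyclic
carriers, chain maps in both directions that do not increase the labels exist and are unique up to
homotopy. Hence they are mutually inverse on homology, and equivariant because the conjugate of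
such a chain map by a permutation is another one.
-/

/-! ### Acyclic carriers -/

namespace SimplicialHomology

noncomputable section

section Simplex

variable {V P : Type*} [Preorder P] {K : PreAbstractSimplicialComplex V} {α : V → P} {q : P}
  {s t : Set V}

/-- The simplices of `K` as sets of vertices, including the empty simplex (of dimension `-1`). A
tuple of vertices is a generator of the augmented ordered chains iff its range is a simplex. -/
def IsSimplex (K : PreAbstractSimplicialComplex V) (s : Set V) : Prop :=
  s = ∅ ∨ ∃ t ∈ K.faces, (t : Set V) = s

theorem isSimplex_empty : IsSimplex K ∅ := Or.inl rfl

theorem IsSimplex.finite (hs : IsSimplex K s) : s.Finite := by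
  rcases hs with rfl | ⟨t, -, rfl⟩
  exacts [Set.finite_empty, t.finite_toSet]

theorem IsSimplex.mono (ht : IsSimplex K t) (hst : s ⊆ t) : IsSimplex K s := by
  lift s to Finset V using ht.finite.subset hst
  rcases s.eq_empty_or_nonempty with rfl | hs
  · exact Or.inl Finset.coe_empty
  · rcases ht with rfl | ⟨t, ht, rfl⟩
    · exact absurd hst (by simpa using hs.ne_empty)
    · exact Or.inr ⟨s, (K.isRelLowerSet_faces ht).2 (Finset.coe_subset.1 hst) hs, rfl⟩

theorem IsSimplex.image_smul {G : Type*} [Group G] [MulAction G V] (hK : IsInvariant G K) (g : G)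
    (hs : IsSimplex K s) : IsSimplex K ((g • ·) '' s) := by
  rcases hs with rfl | ⟨t, ht, rfl⟩
  · exact Or.inl (Set.image_empty _)
  · exact Or.inr ⟨_, hK g t ht, by simp⟩

/-- For a labelling `α` of the vertices of `K`, the subcomplex of the faces all of whose labels are
at most `q`. -/
def sublevel (K : PreAbstractSimplicialComplex V) (α : V → P) (q : P) :
    PreAbstractSimplicialComplex V where
  faces := {s | s ∈ K.faces ∧ ∀ v ∈ s, α v ≤ q}
  isRelLowerSet_faces _ hs :=
    ⟨(K.isRelLowerSet_faces hs.1).1, fun _ hts ht =>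
      ⟨(K.isRelLowerSet_faces hs.1).2 hts ht, fun v hv => hs.2 v (hts hv)⟩⟩

theorem isSimplex_sublevel_iff :
    IsSimplex (sublevel K α q) s ↔ IsSimplex K s ∧ ∀ v ∈ s, α v ≤ q := by
  constructor
  · rintro (rfl | ⟨t, ⟨ht, hq⟩, rfl⟩)
    · exact ⟨isSimplex_empty, fun v hv => hv.elim⟩
    · exact ⟨Or.inr ⟨t, ht, rfl⟩, hq⟩
  · rintro ⟨rfl | ⟨t, ht, rfl⟩, hq⟩
    · exact isSimplex_empty
    · exact Or.inr ⟨t, ⟨ht, hq⟩, rfl⟩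

/-- The complex `K` is a cone with apex `v`. -/
def IsApex (K : PreAbstractSimplicialComplex V) (v : V) : Prop :=
  ∀ s, IsSimplex K s → IsSimplex K (insert v s)

end Simplex

section Boundary

variable {R : Type*} [CommRing R] {V W : Type*}

/-- The cone operator on chains: it puts the vertex `v` in front of each tuple. -/
def cone (R : Type*) [CommRing R] (v : V) (d : ℕ) :
    ((Fin d → V) →₀ R) →ₗ[R] ((Fin (d + 1) → V) →₀ R) :=
  Finsupp.lmapDomain R R fun t => Fin.cons v t

theorem cone_single (v : V) {d : ℕ} (t : Fin d → V) (r : R) :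
    cone R v d (Finsupp.single t r) = Finsupp.single (Fin.cons v t) r := by
  simp [cone]

theorem boundary_single {d : ℕ} (t : Fin (d + 1) → V) (r : R) :
    boundary R V d (Finsupp.single t r) =
      r • ∑ i : Fin (d + 1), (-1 : R) ^ (i : ℕ) • Finsupp.single (t ∘ i.succAbove) (1 : R) := by
  simp only [boundary, Finsupp.linearCombination_single]
  rfl

theorem boundary_cone_zero (v : V) (c : (Fin 0 → V) →₀ R) :
    boundary R V 0 (cone R v 0 c) = c := by
  suffices h : boundary R V 0 ∘ₗ cone R v 0 = LinearMap.id from LinearMap.congr_fun h c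
  refine Finsupp.lhom_ext fun t r => ?_
  simp only [LinearMap.comp_apply, cone_single, boundary_single, LinearMap.id_apply]
  simp [Subsingleton.elim _ t]

theorem boundary_cone_succ (v : V) {d : ℕ} (c : (Fin (d + 1) → V) →₀ R) :
    boundary R V (d + 1) (cone R v (d + 1) c) = c - cone R v d (boundary R V d c) := by
  suffices h : boundary R V (d + 1) ∘ₗ cone R v (d + 1) =
      LinearMap.id - cone R v d ∘ₗ boundary R V d from LinearMap.congr_fun h c
  refine Finsupp.lhom_ext fun t r => ?_
  have face_zero : (Fin.cons v t : Fin (d + 2) → V) ∘ Fin.succAbove 0 = t := by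
    ext j
    simp
  have face_succ (i : Fin (d + 1)) : (Fin.cons v t : Fin (d + 2) → V) ∘ i.succ.succAbove =
      Fin.cons v (t ∘ i.succAbove) := by
    ext j
    cases j using Fin.cases <;> simp
  simp only [LinearMap.comp_apply, LinearMap.sub_apply, cone_single, boundary_single,
    LinearMap.id_apply, map_smul, map_sum]
  rw [Fin.sum_univ_succ, face_zero]
  simp [face_succ, pow_succ, sub_eq_add_neg]

theorem boundary_boundary {d : ℕ} (c : (Fin (d + 2) → V) →₀ R) :
    boundary R V d (boundary R V (d + 1) c) = 0 := by
  suffices h : boundary R V d ∘ₗ boundary R V (d + 1) = 0 from LinearMap.congr_fun h c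
  clear c
  induction d with
  | zero =>
    refine Finsupp.lhom_ext fun t r => ?_
    rw [← Fin.cons_self_tail t, ← cone_single]
    simp [boundary_cone_succ, boundary_cone_zero]
  | succ d ih =>
    refine Finsupp.lhom_ext fun t r => ?_
    have h := LinearMap.congr_fun ih (Finsupp.single (Fin.tail t) r)
    simp only [LinearMap.comp_apply, LinearMap.zero_apply] at h
    rw [← Fin.cons_self_tail t, ← cone_single]
    simp [boundary_cone_succ, h]

/-- Replaces the value of `φ` at each generator `t` by its cone with apex `a t`. When the values of
`φ` are cycles, this lifts `φ` through the boundary map. -/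
def coneFill {ι : Type*} (a : ι → W) {d : ℕ} (φ : (ι →₀ R) →ₗ[R] ((Fin d → W) →₀ R)) :
    (ι →₀ R) →ₗ[R] ((Fin (d + 1) → W) →₀ R) :=
  Finsupp.linearCombination R fun t => cone R (a t) d (φ (Finsupp.single t 1))

theorem coneFill_single {ι : Type*} (a : ι → W) {d : ℕ}
    (φ : (ι →₀ R) →ₗ[R] ((Fin d → W) →₀ R)) (t : ι) :
    coneFill a φ (Finsupp.single t 1) = cone R (a t) d (φ (Finsupp.single t 1)) := by
  simp [coneFill]

theorem boundary_coneFill_zero {ι : Type*} (a : ι → W)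
    (φ : (ι →₀ R) →ₗ[R] ((Fin 0 → W) →₀ R)) (c : ι →₀ R) :
    boundary R W 0 (coneFill a φ c) = φ c := by
  suffices h : boundary R W 0 ∘ₗ coneFill a φ = φ from LinearMap.congr_fun h c
  refine Finsupp.lhom_ext' fun t => LinearMap.ext_ring ?_
  simp only [LinearMap.comp_apply, Finsupp.lsingle_apply, coneFill_single, boundary_cone_zero]

theorem boundary_coneFill_succ {ι : Type*} (a : ι → W) {d : ℕ}
    {φ : (ι →₀ R) →ₗ[R] ((Fin (d + 1) → W) →₀ R)} (hφ : ∀ c, boundary R W d (φ c) = 0)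
    (c : ι →₀ R) : boundary R W (d + 1) (coneFill a φ c) = φ c := by
  suffices h : boundary R W (d + 1) ∘ₗ coneFill a φ = φ from LinearMap.congr_fun h c
  refine Finsupp.lhom_ext' fun t => LinearMap.ext_ring ?_
  simp only [LinearMap.comp_apply, Finsupp.lsingle_apply, coneFill_single, boundary_cone_succ, hφ,
    map_zero, sub_zero]

end Boundary

section ChainMap

variable {R : Type*} [CommRing R] {V W : Type*}

/-- A map of augmented chain complexes, on all linear combinations of tuples, that respects the
augmentation: in degree `-1` it sends the empty tuple to the empty tuple. -/
structure IsAugmentedChainMap (f : ∀ d, ((Fin d → V) →₀ R) →ₗ[R] ((Fin d → W) →₀ R)) : Prop where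
  map_empty : f 0 (Finsupp.single Fin.elim0 1) = Finsupp.single Fin.elim0 1
  boundary_map : ∀ d c, boundary R W d (f (d + 1) c) = f d (boundary R V d c)

variable {f g : ∀ d, ((Fin d → V) →₀ R) →ₗ[R] ((Fin d → W) →₀ R)}

theorem IsAugmentedChainMap.zero_eq (hf : IsAugmentedChainMap f) (hg : IsAugmentedChainMap g) :
    f 0 = g 0 := by
  refine Finsupp.lhom_ext' fun t => LinearMap.ext_ring ?_
  rw [Subsingleton.elim t Fin.elim0]
  exact hf.map_empty.trans hg.map_empty.symm

variable (R) in
/-- The augmented chain map that fills in the image of the boundary of each tuple `t` with the cone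
whose apex is the vertex `a (range t)`. -/
def coneMap (a : Set V → W) : ∀ d, ((Fin d → V) →₀ R) →ₗ[R] ((Fin d → W) →₀ R)
  | 0 => Finsupp.lmapDomain R R fun _ => Fin.elim0
  | d + 1 => coneFill (fun t => a (Set.range t)) (coneMap a d ∘ₗ boundary R V d)

theorem isAugmentedChainMap_coneMap (a : Set V → W) : IsAugmentedChainMap (coneMap R a) where
  map_empty := by simp [coneMap]
  boundary_map d := by
    induction d with
    | zero => exact boundary_coneFill_zero _ _
    | succ d ih => exact boundary_coneFill_succ _ fun c => by simp [ih, boundary_boundary]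

/-- The homotopy between the augmented chain maps `f` and `g` that fills in cycles in the same way
as `coneMap`. -/
def coneHomotopy (a : Set V → W) (f g : ∀ d, ((Fin d → V) →₀ R) →ₗ[R] ((Fin d → W) →₀ R)) :
    ∀ d, ((Fin d → V) →₀ R) →ₗ[R] ((Fin (d + 1) → W) →₀ R)
  | 0 => 0
  | d + 1 => coneFill (fun t => a (Set.range t))
      (f (d + 1) - g (d + 1) - coneHomotopy a f g d ∘ₗ boundary R V d)

theorem boundary_coneHomotopy (a : Set V → W) (hf : IsAugmentedChainMap f)
    (hg : IsAugmentedChainMap g) (d : ℕ) (c : (Fin (d + 1) → V) →₀ R) :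
    boundary R W (d + 1) (coneHomotopy a f g (d + 1) c) =
      f (d + 1) c - g (d + 1) c - coneHomotopy a f g d (boundary R V d c) := by
  induction d with
  | zero =>
    refine boundary_coneFill_succ _ (fun c => ?_) c
    simp [coneHomotopy, hf.boundary_map, hg.boundary_map, hf.zero_eq hg]
  | succ d ih =>
    refine boundary_coneFill_succ _ (fun c => ?_) c
    simp [ih, hf.boundary_map, hg.boundary_map, boundary_boundary]

end ChainMap

section Carrier

variable {R : Type*} [CommRing R] {U V W P : Type*} [Preorder P]
  {K : PreAbstractSimplicialComplex V} {L : PreAbstractSimplicialComplex W}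
  {N : PreAbstractSimplicialComplex U} {α : V → P} {β : W → P} {γ : U → P} {Q : Set P}

theorem single_mem_chains {d : ℕ} {t : Fin d → V} (ht : IsSimplex K (Set.range t)) (r : R) :
    Finsupp.single t r ∈ chains R K d :=
  Finsupp.single_mem_supported R r (ht.imp_left id)

theorem chains_le_iff {d : ℕ} {S : Submodule R ((Fin d → V) →₀ R)} :
    chains R K d ≤ S ↔
      ∀ t : Fin d → V, IsSimplex K (Set.range t) → Finsupp.single t 1 ∈ S := by
  rw [chains, Finsupp.supported_eq_span_single, Submodule.span_le]
  exact Set.forall_mem_image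

theorem chains_mono {K' : PreAbstractSimplicialComplex V}
    (h : ∀ s, IsSimplex K s → IsSimplex K' s) (d : ℕ) : chains R K d ≤ chains R K' d :=
  chains_le_iff.2 fun _ ht => single_mem_chains (h _ ht) 1

theorem chains_sublevel_mono {p q : P} (hpq : p ≤ q) (d : ℕ) :
    chains R (sublevel K α p) d ≤ chains R (sublevel K α q) d :=
  chains_mono (fun _ hs => isSimplex_sublevel_iff.2
    ((isSimplex_sublevel_iff.1 hs).imp_right fun h v hv => (h v hv).trans hpq)) d

theorem chains_le_comap_boundary (d : ℕ) :
    chains R K (d + 1) ≤ (chains R K d).comap (boundary R V d) := by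
  refine chains_le_iff.2 fun t ht => ?_
  rw [Submodule.mem_comap, boundary_single]
  exact Submodule.smul_mem _ _ (Submodule.sum_mem _ fun i _ => Submodule.smul_mem _ _
    (single_mem_chains (ht.mono (Set.range_comp_subset_range _ t)) 1))

theorem chains_le_comap_cone {v : V} (hv : IsApex K v) (d : ℕ) :
    chains R K d ≤ (chains R K (d + 1)).comap (cone R v d) := by
  refine chains_le_iff.2 fun t ht => ?_
  rw [Submodule.mem_comap, cone_single]
  refine single_mem_chains ?_ 1
  rw [Fin.range_cons]
  exact hv _ ht

/-- The linear map `φ` takes chains on simplices with labels at most `q` to chains of the same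
kind, for all `q`. -/
def PreservesSublevels (K : PreAbstractSimplicialComplex V) (α : V → P)
    (L : PreAbstractSimplicialComplex W) (β : W → P) {d e : ℕ}
    (φ : ((Fin d → V) →₀ R) →ₗ[R] ((Fin e → W) →₀ R)) : Prop :=
  ∀ q, chains R (sublevel K α q) d ≤ (chains R (sublevel L β q) e).comap φ

theorem preservesSublevels_boundary (d : ℕ) :
    PreservesSublevels K α K α (boundary R V d) :=
  fun _ => chains_le_comap_boundary d

theorem chains_sublevel_le_comap_tupleRep {G : Type*} [Group G] [MulAction G V] [MulAction G P]
    (hP : ∀ g : G, Monotone (g • · : P → P)) (hα : ∀ (g : G) (v : V), α (g • v) = g • α v)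
    (hK : IsInvariant G K) (g : G) (q : P) (d : ℕ) :
    chains R (sublevel K α q) d ≤
      (chains R (sublevel K α (g • q)) d).comap (tupleRep R G V d g) := by
  refine chains_le_iff.2 fun t ht => ?_
  obtain ⟨htK, htq⟩ := isSimplex_sublevel_iff.1 ht
  have hrange : Set.range (g • t) = (g • ·) '' Set.range t := Set.range_comp (g • ·) t
  rw [Submodule.mem_comap, tupleRep_single]
  refine single_mem_chains (isSimplex_sublevel_iff.2 ?_) 1
  rw [hrange, Set.forall_mem_image]
  exact ⟨htK.image_smul hK g, fun v hv => (hα g v).le.trans (hP g (htq v hv))⟩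

namespace PreservesSublevels

variable {d e m : ℕ}

theorem comp {ψ : ((Fin e → W) →₀ R) →ₗ[R] ((Fin m → U) →₀ R)}
    {φ : ((Fin d → V) →₀ R) →ₗ[R] ((Fin e → W) →₀ R)} (hψ : PreservesSublevels L β N γ ψ)
    (hφ : PreservesSublevels K α L β φ) : PreservesSublevels K α N γ (ψ ∘ₗ φ) :=
  fun q => (hφ q).trans (Submodule.comap_mono (hψ q))

variable {φ ψ : ((Fin d → V) →₀ R) →ₗ[R] ((Fin e → W) →₀ R)}

theorem sub (hφ : PreservesSublevels K α L β φ) (hψ : PreservesSublevels K α L β ψ) :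
    PreservesSublevels K α L β (φ - ψ) :=
  fun q _ hc => Submodule.sub_mem (chains R (sublevel L β q) e) (hφ q hc) (hψ q hc)

theorem chains_le_comap (hφ : PreservesSublevels K α L β φ)
    (hα : ∀ s, IsSimplex K s → BddAbove (α '' s)) : chains R K d ≤ (chains R L e).comap φ := by
  refine chains_le_iff.2 fun t ht => ?_
  obtain ⟨q, hq⟩ := hα _ ht
  exact chains_mono (fun s hs => (isSimplex_sublevel_iff.1 hs).1) e (hφ q
    (single_mem_chains (isSimplex_sublevel_iff.2 ⟨ht, fun v hv => hq ⟨v, hv, rfl⟩⟩) 1))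

end PreservesSublevels

/-- The function `a` assigns to each nonempty simplex `s` of `K` an apex of the sublevel complex of
`L` at the join of the labels of `s`. -/
def IsApexChoice (K : PreAbstractSimplicialComplex V) (α : V → P)
    (L : PreAbstractSimplicialComplex W) (β : W → P) (a : Set V → W) : Prop :=
  ∀ s, IsSimplex K s → s.Nonempty → ∃ q, IsLUB (α '' s) q ∧ IsApex (sublevel L β q) (a s)

theorem PreservesSublevels.coneFill {a : Set V → W} (ha : IsApexChoice K α L β a) {d e : ℕ}
    {φ : ((Fin (d + 1) → V) →₀ R) →ₗ[R] ((Fin e → W) →₀ R)} (hφ : PreservesSublevels K α L β φ) :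
    PreservesSublevels K α L β (coneFill (fun t => a (Set.range t)) φ) := by
  refine fun q => chains_le_iff.2 fun t ht => ?_
  obtain ⟨htK, htq⟩ := isSimplex_sublevel_iff.1 ht
  obtain ⟨p, hp, hapex⟩ := ha _ htK (Set.range_nonempty t)
  have hpq : p ≤ q := hp.2 (Set.forall_mem_image.2 fun v hv => htq v hv)
  have htp : Finsupp.single t (1 : R) ∈ chains R (sublevel K α p) (d + 1) :=
    single_mem_chains (isSimplex_sublevel_iff.2 ⟨htK, fun v hv => hp.1 ⟨v, hv, rfl⟩⟩) 1
  rw [Submodule.mem_comap, coneFill_single]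
  exact chains_sublevel_mono hpq (e + 1) (chains_le_comap_cone hapex e (hφ p htp))

/-- An augmented chain map that is carried by the sublevel complexes, in the sense of the acyclic
carrier theorem. -/
structure IsCarried (K : PreAbstractSimplicialComplex V) (α : V → P)
    (L : PreAbstractSimplicialComplex W) (β : W → P)
    (f : ∀ d, ((Fin d → V) →₀ R) →ₗ[R] ((Fin d → W) →₀ R)) : Prop extends
    IsAugmentedChainMap f where
  carried : ∀ d, PreservesSublevels K α L β (f d)

theorem isCarried_id : IsCarried (R := R) K α K α fun _ => LinearMap.id where
  map_empty := rfl
  boundary_map _ _ := rfl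
  carried _ _ := le_rfl

theorem IsCarried.comp {f : ∀ d, ((Fin d → V) →₀ R) →ₗ[R] ((Fin d → W) →₀ R)}
    {g : ∀ d, ((Fin d → W) →₀ R) →ₗ[R] ((Fin d → U) →₀ R)} (hg : IsCarried L β N γ g)
    (hf : IsCarried K α L β f) : IsCarried K α N γ fun d => g d ∘ₗ f d where
  map_empty := by simp [hf.map_empty, hg.map_empty]
  boundary_map d c := by simp [hf.boundary_map, hg.boundary_map]
  carried d := (hg.carried d).comp (hf.carried d)

theorem isCarried_coneMap {a : Set V → W} (ha : IsApexChoice K α L β a) :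
    IsCarried K α L β (coneMap R a) where
  toIsAugmentedChainMap := isAugmentedChainMap_coneMap a
  carried d := by
    induction d with
    | zero =>
      refine fun q => chains_le_iff.2 fun t _ => ?_
      rw [Submodule.mem_comap, coneMap, Finsupp.lmapDomain_apply, Finsupp.mapDomain_single]
      exact single_mem_chains (Or.inl (Set.range_eq_empty _)) 1
    | succ d ih => exact (ih.comp (preservesSublevels_boundary d)).coneFill ha

variable {f g : ∀ d, ((Fin d → V) →₀ R) →ₗ[R] ((Fin d → W) →₀ R)}

theorem preservesSublevels_coneHomotopy {a : Set V → W} (ha : IsApexChoice K α L β a)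
    (hf : IsCarried K α L β f) (hg : IsCarried K α L β g) (d : ℕ) :
    PreservesSublevels K α L β (coneHomotopy a f g d) := by
  induction d with
  | zero => exact fun q _ _ => (chains R (sublevel L β q) 1).zero_mem
  | succ d ih =>
    exact (((hf.carried _).sub (hg.carried _)).sub
      (ih.comp (preservesSublevels_boundary d))).coneFill ha

theorem IsCarried.sub_mem_boundaries {a : Set V → W} (ha : IsApexChoice K α L β a)
    (hα : ∀ s, IsSimplex K s → BddAbove (α '' s)) (hf : IsCarried K α L β f)
    (hg : IsCarried K α L β g) (d : ℕ) {z : (Fin d → V) →₀ R} (hz : z ∈ cycles R K d) :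
    f d z - g d z ∈ boundaries R L d := by
  cases d with
  | zero =>
    rw [hf.zero_eq hg.toIsAugmentedChainMap, sub_self]
    exact Submodule.zero_mem _
  | succ d =>
    refine ⟨coneHomotopy a f g (d + 1) z,
      (preservesSublevels_coneHomotopy ha hf hg (d + 1)).chains_le_comap hα hz.1, ?_⟩
    rw [boundary_coneHomotopy a hf.toIsAugmentedChainMap hg.toIsAugmentedChainMap,
      LinearMap.mem_ker.1 hz.2, map_zero, sub_zero]

theorem IsCarried.cycles_le_comap (hα : ∀ s, IsSimplex K s → BddAbove (α '' s))
    (hf : IsCarried K α L β f) (d : ℕ) : cycles R K d ≤ (cycles R L d).comap (f d) := by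
  cases d with
  | zero => exact (hf.carried 0).chains_le_comap hα
  | succ d =>
    refine fun c hc => ⟨(hf.carried _).chains_le_comap hα hc.1, ?_⟩
    rw [SetLike.mem_coe, LinearMap.mem_ker, hf.boundary_map, LinearMap.mem_ker.1 hc.2, map_zero]

theorem IsCarried.boundaries_le_comap (hα : ∀ s, IsSimplex K s → BddAbove (α '' s))
    (hf : IsCarried K α L β f) (d : ℕ) :
    boundaries R K d ≤ (boundaries R L d).comap (f d) := by
  rintro _ ⟨c, hc, rfl⟩
  exact ⟨f (d + 1) c, (hf.carried _).chains_le_comap hα hc, hf.boundary_map d c⟩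

/-- The labels of every nonempty simplex have a least upper bound, which lies in `Q`, and the
sublevel complexes at the elements of `Q` are cones. -/
structure HasConeFibers (K : PreAbstractSimplicialComplex V) (α : V → P) (Q : Set P) : Prop where
  exists_isLUB : ∀ s, IsSimplex K s → s.Nonempty → ∃ q ∈ Q, IsLUB (α '' s) q
  exists_isApex : ∀ q ∈ Q, ∃ v, IsApex (sublevel K α q) v

theorem HasConeFibers.bddAbove [Nonempty P] (hK : HasConeFibers K α Q) (s : Set V)
    (hs : IsSimplex K s) : BddAbove (α '' s) := by
  rcases s.eq_empty_or_nonempty with rfl | hne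
  · simp
  · obtain ⟨q, -, hq⟩ := hK.exists_isLUB s hs hne
    exact hq.bddAbove

theorem HasConeFibers.exists_isApexChoice [Nonempty W] (hK : HasConeFibers K α Q)
    (hL : HasConeFibers L β Q) : ∃ a : Set V → W, IsApexChoice K α L β a := by
  have (s : Set V) : ∃ w : W, IsSimplex K s → s.Nonempty →
      ∃ q, IsLUB (α '' s) q ∧ IsApex (sublevel L β q) w := by
    by_cases h : IsSimplex K s ∧ s.Nonempty
    · obtain ⟨q, hqQ, hq⟩ := hK.exists_isLUB s h.1 h.2
      obtain ⟨w, hw⟩ := hL.exists_isApex q hqQ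
      exact ⟨w, fun _ _ => ⟨q, hq, hw⟩⟩
    · exact ⟨Classical.arbitrary W, fun hs hne => absurd ⟨hs, hne⟩ h⟩
  choose a ha using this
  exact ⟨a, ha⟩

end Carrier

section Homology

variable {R : Type*} [CommRing R] {U V W P : Type*} [Preorder P]
  {K : PreAbstractSimplicialComplex V} {L : PreAbstractSimplicialComplex W}
  {N : PreAbstractSimplicialComplex U} {α : V → P} {β : W → P} {γ : U → P} {Q : Set P}

namespace IsCarried

variable {f f' : ∀ d, ((Fin d → V) →₀ R) →ₗ[R] ((Fin d → W) →₀ R)}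
  {g : ∀ d, ((Fin d → W) →₀ R) →ₗ[R] ((Fin d → U) →₀ R)}

/-- The map that a carried chain map induces on reduced homology. -/
def mapHomology (hf : IsCarried K α L β f) (hα : ∀ s, IsSimplex K s → BddAbove (α '' s)) (d : ℕ) :
    ReducedHomology R K d →ₗ[R] ReducedHomology R L d :=
  Submodule.mapQ _ _ ((f d).restrict (hf.cycles_le_comap hα d))
    fun _ hc => hf.boundaries_le_comap hα d hc

theorem mapHomology_id (hα : ∀ s, IsSimplex K s → BddAbove (α '' s)) (d : ℕ) :
    (isCarried_id (R := R) (K := K) (α := α)).mapHomology hα d = LinearMap.id :=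
  Submodule.linearMap_qext _ rfl

theorem mapHomology_comp (hg : IsCarried L β N γ g) (hf : IsCarried K α L β f)
    (hα : ∀ s, IsSimplex K s → BddAbove (α '' s)) (hβ : ∀ s, IsSimplex L s → BddAbove (β '' s))
    (d : ℕ) : hg.mapHomology hβ d ∘ₗ hf.mapHomology hα d = (hg.comp hf).mapHomology hα d :=
  Submodule.linearMap_qext _ rfl

theorem mapHomology_eq {a : Set V → W} (ha : IsApexChoice K α L β a) (hf : IsCarried K α L β f)
    (hf' : IsCarried K α L β f') (hα : ∀ s, IsSimplex K s → BddAbove (α '' s)) (d : ℕ) :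
    hf.mapHomology hα d = hf'.mapHomology hα d :=
  Submodule.linearMap_qext _ <| LinearMap.ext fun z =>
    (Submodule.Quotient.eq _).2 (hf.sub_mem_boundaries ha hα hf' d z.2)

end IsCarried

variable {G : Type*} [Group G] [MulAction G V] [MulAction G W] [MulAction G P]
  {f : ∀ d, ((Fin d → V) →₀ R) →ₗ[R] ((Fin d → W) →₀ R)}

theorem IsCarried.conj (hP : ∀ g : G, Monotone (g • · : P → P))
    (hα : ∀ (g : G) (v : V), α (g • v) = g • α v) (hβ : ∀ (g : G) (w : W), β (g • w) = g • β w)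
    (hK : IsInvariant G K) (hL : IsInvariant G L) (hf : IsCarried K α L β f) (g : G) :
    IsCarried K α L β fun d => tupleRep R G W d g⁻¹ ∘ₗ f d ∘ₗ tupleRep R G V d g where
  map_empty := by
    simp only [LinearMap.comp_apply, tupleRep_single]
    rw [Subsingleton.elim (g • (Fin.elim0 : Fin 0 → V)) Fin.elim0, hf.map_empty, tupleRep_single,
      Subsingleton.elim (g⁻¹ • (Fin.elim0 : Fin 0 → W)) Fin.elim0]
  boundary_map d c := by simp only [LinearMap.comp_apply, boundary_tupleRep, hf.boundary_map]
  carried d q c hc := by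
    have h := chains_sublevel_le_comap_tupleRep hP hβ hL g⁻¹ (g • q) d
      (hf.carried d (g • q) (chains_sublevel_le_comap_tupleRep hP hα hK g q d hc))
    rwa [inv_smul_smul] at h

theorem IsCarried.mapHomology_comp_rep {a : Set V → W} (ha : IsApexChoice K α L β a)
    (hαK : ∀ s, IsSimplex K s → BddAbove (α '' s)) (hP : ∀ g : G, Monotone (g • · : P → P))
    (hα : ∀ (g : G) (v : V), α (g • v) = g • α v) (hβ : ∀ (g : G) (w : W), β (g • w) = g • β w)
    (hK : IsInvariant G K) (hL : IsInvariant G L) (hf : IsCarried K α L β f) (g : G) (d : ℕ) :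
    hf.mapHomology hαK d ∘ₗ reducedHomologyRep R K hK d g =
      reducedHomologyRep R L hL d g ∘ₗ hf.mapHomology hαK d := by
  have map_conj : (hf.conj hP hα hβ hK hL g).mapHomology hαK d =
      reducedHomologyRep R L hL d g⁻¹ ∘ₗ hf.mapHomology hαK d ∘ₗ reducedHomologyRep R K hK d g :=
    Submodule.linearMap_qext _ rfl
  refine LinearMap.ext fun x => ?_
  have hx := LinearMap.congr_fun (map_conj.symm.trans (mapHomology_eq ha _ hf hαK d)) x
  simp only [LinearMap.comp_apply] at hx ⊢
  rw [← hx, Representation.self_inv_apply]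

theorem nonempty_reducedHomologyRep_equiv [Nonempty V] [Nonempty W]
    (hP : ∀ g : G, Monotone (g • · : P → P)) (hα : ∀ (g : G) (v : V), α (g • v) = g • α v)
    (hβ : ∀ (g : G) (w : W), β (g • w) = g • β w) (hK : IsInvariant G K) (hL : IsInvariant G L)
    (hKQ : HasConeFibers K α Q) (hLQ : HasConeFibers L β Q) (d : ℕ) :
    Nonempty ((reducedHomologyRep R K hK d).Equiv (reducedHomologyRep R L hL d)) := by
  have : Nonempty P := .map α ‹_›
  obtain ⟨a, ha⟩ := hKQ.exists_isApexChoice hLQ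
  obtain ⟨b, hb⟩ := hLQ.exists_isApexChoice hKQ
  obtain ⟨aK, haK⟩ := hKQ.exists_isApexChoice hKQ
  obtain ⟨aL, haL⟩ := hLQ.exists_isApexChoice hLQ
  have hf : IsCarried K α L β (coneMap R a) := isCarried_coneMap ha
  have hg : IsCarried L β K α (coneMap R b) := isCarried_coneMap hb
  have left_inv : hg.mapHomology hLQ.bddAbove d ∘ₗ hf.mapHomology hKQ.bddAbove d =
      LinearMap.id := by
    rw [IsCarried.mapHomology_comp, ← IsCarried.mapHomology_id hKQ.bddAbove]
    exact IsCarried.mapHomology_eq haK _ _ _ d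
  have right_inv : hf.mapHomology hKQ.bddAbove d ∘ₗ hg.mapHomology hLQ.bddAbove d =
      LinearMap.id := by
    rw [IsCarried.mapHomology_comp, ← IsCarried.mapHomology_id hLQ.bddAbove]
    exact IsCarried.mapHomology_eq haL _ _ _ d
  exact ⟨.mk (.ofLinearMap _ _ right_inv left_inv)
    fun g => hf.mapHomology_comp_rep ha hKQ.bddAbove hP hα hβ hK hL g d⟩

end Homology

end

end SimplicialHomology

/-! ### Clusters of trees -/

namespace KEqualTree

/-- Two sets are laminar if they are nested or disjoint. -/
def Laminar {ι : Type*} (A B : Set ι) : Prop := A ⊆ B ∨ B ⊆ A ∨ Disjoint A B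

namespace Laminar

variable {ι : Type*} {A B : Set ι}

theorem symm (h : Laminar A B) : Laminar B A := by
  rcases h with h | h | h
  exacts [.inr (.inl h), .inl h, .inr (.inr h.symm)]

theorem refl (A : Set ι) : Laminar A A := .inl subset_rfl

theorem nested (h : Laminar A B) {i : ι} (hA : i ∈ A) (hB : i ∈ B) : A ⊆ B ∨ B ⊆ A :=
  or_assoc.2 h |>.resolve_right (Set.not_disjoint_iff.2 ⟨i, hA, hB⟩)

theorem singleton_left (i : ι) (A : Set ι) : Laminar {i} A := by
  by_cases h : i ∈ A
  · exact .inl (Set.singleton_subset_iff.2 h)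
  · exact .inr (.inr (Set.disjoint_singleton_left.2 h))

theorem univ_left (A : Set ι) : Laminar Set.univ A := .inr (.inl A.subset_univ)

end Laminar

namespace LabelledTree

section Cluster

variable {n : ℕ} {T : LabelledTree n} {u v : T.tree} {i : Fin n}

instance (T : LabelledTree n) : Finite T.tree := T.finite

/-- The cluster of a vertex: the set of the labels of the leaves below it. The clusters of a
labelled tree determine its combinatorial type. -/
def cluster (T : LabelledTree n) (v : T.tree) : Set (Fin n) :=
  {i | v ≤ T.leaf i}

theorem mem_cluster : i ∈ T.cluster v ↔ v ≤ T.leaf i := Iff.rfl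

theorem cluster_anti (h : u ≤ v) : T.cluster v ⊆ T.cluster u :=
  fun _ hi => h.trans hi

theorem cluster_bot : T.cluster ⊥ = Set.univ := Set.eq_univ_of_forall fun _ => bot_le

theorem isMax_leaf (i : Fin n) : IsMax (T.leaf i : T.tree) := (T.leaf i).2

theorem exists_leaf_eq (hv : IsMax v) : ∃ i, (T.leaf i : T.tree) = v :=
  ⟨T.leaf.symm ⟨v, hv⟩, by simp⟩

theorem leaf_injective : Function.Injective fun i => (T.leaf i : T.tree) :=
  Subtype.val_injective.comp T.leaf.injective

theorem pred_leaf_lt (i : Fin n) : Order.pred (T.leaf i : T.tree) < T.leaf i :=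
  Order.pred_lt_of_not_isMin fun h => T.root_not_leaf (h.eq_bot ▸ isMax_leaf i)

theorem cluster_leaf (i : Fin n) : T.cluster (T.leaf i) = {i} := by
  ext j
  rw [mem_cluster, Set.mem_singleton_iff]
  constructor
  · exact fun h => leaf_injective ((isMax_leaf i).eq_of_le h).symm
  · rintro rfl
    exact le_rfl

theorem cluster_nonempty (v : T.tree) : (T.cluster v).Nonempty := by
  obtain ⟨w, hvw, hw⟩ := Set.finite_univ.exists_le_maximal (Set.mem_univ v)
  obtain ⟨i, rfl⟩ := exists_leaf_eq (isMax_iff_forall_not_lt.2 fun x hx =>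
    hw.not_prop_of_gt hx trivial)
  exact ⟨i, hvw⟩

theorem le_total_of_mem_cluster (hu : i ∈ T.cluster u) (hv : i ∈ T.cluster v) : u ≤ v ∨ v ≤ u :=
  (le_total_of_directed (mem_cluster.1 hu) (mem_cluster.1 hv)).symm

theorem laminar_cluster (u v : T.tree) : Laminar (T.cluster u) (T.cluster v) := by
  by_cases h : Disjoint (T.cluster u) (T.cluster v)
  · exact .inr (.inr h)
  · obtain ⟨i, hu, hv⟩ := Set.not_disjoint_iff.1 h
    rcases le_total_of_mem_cluster hu hv with h | h
    exacts [.inr (.inl (cluster_anti h)), .inl (cluster_anti h)]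

theorem disjoint_cluster_of_covBy {a b : T.tree} (ha : u ⋖ a) (hb : u ⋖ b) (hab : a ≠ b) :
    Disjoint (T.cluster a) (T.cluster b) := by
  refine Set.disjoint_left.2 fun i hia hib => ?_
  rcases le_total_of_mem_cluster hia hib with h | h
  · exact hab ((hb.eq_or_eq ha.le h).resolve_left ha.ne')
  · exact hab ((ha.eq_or_eq hb.le h).resolve_left hb.ne').symm

theorem cluster_ssubset (h : u < v) : T.cluster v ⊂ T.cluster u := by
  refine ⟨cluster_anti h.le, fun hsub => ?_⟩
  obtain ⟨a, ha, hav⟩ := exists_covBy_le_of_lt h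
  obtain ⟨b, hb, hba⟩ := Set.exists_ne_of_one_lt_ncard (T.two_le_outdegree u h.not_isMax) a
  obtain ⟨i, hi⟩ := cluster_nonempty b
  exact Set.disjoint_left.1 (disjoint_cluster_of_covBy hb ha hba) hi
    (cluster_anti hav (hsub (cluster_anti hb.le hi)))

theorem cluster_subset_iff : T.cluster u ⊆ T.cluster v ↔ v ≤ u := by
  refine ⟨fun h => ?_, cluster_anti⟩
  obtain ⟨i, hi⟩ := cluster_nonempty u
  rcases le_total_of_mem_cluster hi (h hi) with huv | hvu
  · by_contra hvu
    exact (cluster_ssubset (lt_of_le_not_ge huv hvu)).2 h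
  · exact hvu

theorem cluster_injective : Function.Injective T.cluster := fun _ _ h =>
  le_antisymm (cluster_subset_iff.1 h.ge) (cluster_subset_iff.1 h.le)

theorem not_isMax_iff : ¬ IsMax v ↔ (T.cluster v).Nontrivial := by
  refine ⟨fun hv => ?_, fun h hv => ?_⟩
  · obtain ⟨i, hi⟩ := cluster_nonempty v
    have hlt : v < T.leaf i := lt_of_le_of_ne hi fun h => hv (h ▸ isMax_leaf i)
    have hssub := cluster_ssubset hlt
    rw [cluster_leaf] at hssub
    exact Set.nontrivial_iff_ne_singleton hi |>.2 hssub.ne'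
  · obtain ⟨i, rfl⟩ := exists_leaf_eq hv
    rw [cluster_leaf] at h
    exact Set.not_nontrivial_singleton h

end Cluster

section Contraction

variable {n : ℕ} {T S : LabelledTree n}

theorem exists_galoisConnection_of_cluster_eq {g : S.tree → T.tree}
    (hg : ∀ w, T.cluster (g w) = S.cluster w) : ∃ f : T.tree → S.tree, GaloisConnection g f := by
  suffices h : ∀ v : T.tree, ∃ w : S.tree, ∀ x : S.tree, g x ≤ v ↔ x ≤ w by
    choose f hf using h
    exact ⟨f, fun x v => hf v x⟩
  intro v
  have hbot : g ⊥ ≤ v := by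
    rw [← cluster_subset_iff, hg, cluster_bot]
    exact Set.subset_univ _
  obtain ⟨w, hw⟩ := (Set.toFinite {x : S.tree | g x ≤ v}).exists_maximal ⟨⊥, hbot⟩
  obtain ⟨i, hi⟩ := cluster_nonempty v
  have mem_of_le : ∀ x : S.tree, g x ≤ v → i ∈ S.cluster x := fun x hx => by
    rw [← hg]
    exact cluster_anti hx hi
  refine ⟨w, fun x => ⟨fun hx => ?_, fun hx => le_trans ?_ hw.prop⟩⟩
  · rcases le_total_of_mem_cluster (mem_of_le x hx) (mem_of_le w hw.prop) with h | h
    exacts [h, hw.le_of_ge hx h]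
  · rw [← cluster_subset_iff, hg, hg]
    exact cluster_anti hx

theorem isContractionMap_of_galoisConnection {g : S.tree → T.tree} {f : T.tree → S.tree}
    (hg : ∀ w, T.cluster (g w) = S.cluster w) (gc : GaloisConnection g f) :
    IsContractionMap T S f := by
  have hfg : ∀ w, f (g w) = w := fun w => by
    refine le_antisymm ?_ (gc.le_u_l w)
    rw [← cluster_subset_iff, ← hg, ← hg, cluster_subset_iff]
    exact gc.l_u_le _
  have hleaf : ∀ i, g (S.leaf i) = T.leaf i := fun i =>
    cluster_injective (by rw [hg, cluster_leaf, cluster_leaf])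
  have hroot : g ⊥ = ⊥ := cluster_injective (by rw [hg, cluster_bot, cluster_bot])
  refine ⟨fun w => ⟨g w, hfg w⟩, by rw [← hroot, hfg], fun i => by rw [← hleaf, hfg], ?_, ?_, ?_⟩
  · intro v _
    rw [or_iff_not_imp_left]
    refine fun hne => ⟨(gc.monotone_u (Order.pred_le v)).lt_of_ne hne, fun w hw hwv => ?_⟩
    have hgw : g w < v := (gc.le_iff_le.2 hwv.le).lt_of_ne fun h => hwv.ne (by rw [← h, hfg])
    exact hw.not_ge (gc.le_iff_le.1 (Order.le_pred_of_lt hgw))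
  · intro i hi
    refine (pred_leaf_lt (T := T) i).not_ge ?_
    rw [← hleaf, gc.le_iff_le, hleaf, hi, ← hleaf, hfg]
  · intro u v huv
    rw [gc.u_inf, ← huv, inf_idem]

namespace IsContractionMap

variable {f : T.tree → S.tree}

theorem monotone (hf : IsContractionMap T S f) : Monotone f :=
  monotone_of_pred_le fun v hv => by
    rcases hf.edge v (fun h => hv (h ▸ isMin_bot)) with h | h
    exacts [h.le, h.le]

theorem exists_isLeast_fiber (hf : IsContractionMap T S f) (w : S.tree) :
    ∃ v, IsLeast {v | f v = w} v := by
  obtain ⟨v, hv⟩ := (Set.toFinite {v : T.tree | f v = w}).exists_minimal (hf.surjective w)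
  refine ⟨v, hv.prop, fun u hu => ?_⟩
  have hinf : f (v ⊓ u) = w := (hf.connected v u (hv.prop.trans hu.symm)).trans hv.prop
  exact (hv.le_of_le hinf inf_le_left).trans inf_le_right

theorem exists_le_map_eq (hf : IsContractionMap T S f) {v : T.tree} {w : S.tree} (hw : w ≤ f v) :
    ∃ u ≤ v, f u = w := by
  obtain ⟨u, hu⟩ := (Set.toFinite {u | u ≤ v ∧ w ≤ f u}).exists_minimal ⟨v, le_rfl, hw⟩
  refine ⟨u, hu.prop.1, ?_⟩
  rcases eq_or_ne u ⊥ with rfl | hb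
  · have hbot := hu.prop.2
    rw [hf.map_root, le_bot_iff] at hbot
    rw [hf.map_root, hbot]
  · have hlt : Order.pred u < u := Order.pred_lt_of_not_isMin fun h => hb h.eq_bot
    have hnot : ¬ w ≤ f (Order.pred u) := fun h =>
      hu.not_prop_of_lt hlt ⟨hlt.le.trans hu.prop.1, h⟩
    rcases hf.edge u hb with h | h
    · exact absurd (h ▸ hu.prop.2) hnot
    · have hle := (le_total_of_directed h.le hu.prop.2).resolve_left hnot
      exact ((h.eq_or_eq hle hu.prop.2).resolve_left fun e => hnot e.le).symm

theorem exists_cluster_eq (hf : IsContractionMap T S f) (w : S.tree) :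
    ∃ v : T.tree, T.cluster v = S.cluster w := by
  obtain ⟨v, rfl, hv⟩ := hf.exists_isLeast_fiber w
  refine ⟨v, Set.ext fun i => ?_⟩
  rw [mem_cluster, mem_cluster, ← hf.map_leaf]
  refine ⟨fun hi => hf.monotone hi, fun hi => ?_⟩
  obtain ⟨u, hui, hu⟩ := hf.exists_le_map_eq hi
  exact (hv hu).trans hui

end IsContractionMap

theorem contractsTo_iff_forall_exists_cluster_eq :
    T.ContractsTo S ↔ ∀ w : S.tree, ∃ v : T.tree, T.cluster v = S.cluster w := by
  refine ⟨fun ⟨f, hf⟩ => hf.exists_cluster_eq, fun h => ?_⟩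
  choose g hg using h
  obtain ⟨f, gc⟩ := exists_galoisConnection_of_cluster_eq hg
  exact ⟨f, isContractionMap_of_galoisConnection hg gc⟩

/-- The clusters of the internal edges of a tree, which are its proper clusters with at least two
elements. -/
def edgeClusters (T : LabelledTree n) : Set (Set (Fin n)) :=
  T.cluster '' T.internalEdges

theorem mem_edgeClusters {A : Set (Fin n)} :
    A ∈ T.edgeClusters ↔ A ≠ Set.univ ∧ A.Nontrivial ∧ ∃ v, T.cluster v = A := by
  constructor
  · rintro ⟨v, ⟨hb, hm⟩, rfl⟩
    exact ⟨fun h => hb (cluster_injective (h.trans cluster_bot.symm)), not_isMax_iff.1 hm, v, rfl⟩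
  · rintro ⟨hu, hn, v, rfl⟩
    refine ⟨v, ⟨?_, not_isMax_iff.2 hn⟩, rfl⟩
    rintro rfl
    exact hu cluster_bot

theorem ncard_edgeClusters : T.edgeClusters.ncard = T.internalEdges.ncard :=
  Set.ncard_image_of_injective _ cluster_injective

theorem contractsTo_iff_edgeClusters_subset :
    T.ContractsTo S ↔ S.edgeClusters ⊆ T.edgeClusters := by
  rw [contractsTo_iff_forall_exists_cluster_eq]
  refine ⟨fun h A hA => ?_, fun h w => ?_⟩
  · obtain ⟨hu, hn, w, rfl⟩ := mem_edgeClusters.1 hA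
    exact mem_edgeClusters.2 ⟨hu, hn, h w⟩
  · by_cases hb : w = ⊥
    · exact ⟨⊥, by rw [hb, cluster_bot, cluster_bot]⟩
    by_cases hm : IsMax w
    · obtain ⟨i, rfl⟩ := exists_leaf_eq hm
      exact ⟨T.leaf i, by rw [cluster_leaf, cluster_leaf]⟩
    · exact (mem_edgeClusters.1 (h ⟨w, ⟨hb, hm⟩, rfl⟩)).2.2

theorem SameType.edgeClusters_eq (h : SameType T S) : T.edgeClusters = S.edgeClusters := by
  suffices key : ∀ {T S : LabelledTree n}, SameType T S → T.edgeClusters ⊆ S.edgeClusters from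
    (key h).antisymm (key ((typeSetoid n).iseqv.symm h))
  rintro T S ⟨e, he⟩ A hA
  obtain ⟨hu, hn, v, rfl⟩ := mem_edgeClusters.1 hA
  refine mem_edgeClusters.2 ⟨hu, hn, e v, Set.ext fun i => ?_⟩
  rw [mem_cluster, mem_cluster, ← he, e.le_iff_le]

theorem edgeClusters_relabel (σ : Equiv.Perm (Fin n)) (T : LabelledTree n) :
    (T.relabel σ).edgeClusters = Set.image σ '' T.edgeClusters := by
  rw [edgeClusters, edgeClusters, Set.image_image]
  refine Set.image_congr fun v _ => Set.ext fun i => ?_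
  rw [Set.mem_image_equiv]
  rfl

end Contraction

end LabelledTree

/-- The conditions for a family of sets to be the family of the clusters of a rooted tree. -/
structure IsTreeFamily {ι : Type*} (F : Set (Set ι)) : Prop where
  univ_mem : Set.univ ∈ F
  singleton_mem : ∀ x, {x} ∈ F
  nonempty : ∀ A ∈ F, A.Nonempty
  laminar : ∀ A ∈ F, ∀ B ∈ F, Laminar A B

namespace IsTreeFamily

section Order

variable {ι : Type*} {F : Set (Set ι)}

theorem of_laminar [Nonempty ι] (hne : ∀ A ∈ F, A.Nonempty)
    (hl : ∀ A ∈ F, ∀ B ∈ F, Laminar A B) :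
    IsTreeFamily (F ∪ insert Set.univ (Set.range singleton)) where
  univ_mem := .inr (.inl rfl)
  singleton_mem x := .inr (.inr ⟨x, rfl⟩)
  nonempty := by
    rintro A (hA | rfl | ⟨x, rfl⟩)
    exacts [hne A hA, Set.univ_nonempty, Set.singleton_nonempty x]
  laminar := by
    rintro A (hA | rfl | ⟨x, rfl⟩) B hB
    · rcases hB with hB | rfl | ⟨y, rfl⟩
      exacts [hl A hA B hB, (Laminar.univ_left A).symm, (Laminar.singleton_left y A).symm]
    · exact .univ_left B
    · exact .singleton_left x B

variable [Finite ι] (hF : IsTreeFamily F)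
include hF

theorem exists_isLeast {S : Set (Set ι)} (hS : S ⊆ F) (hne : S.Nonempty) {x : ι}
    (hx : ∀ A ∈ S, x ∈ A) : ∃ A, IsLeast S A := by
  obtain ⟨A, hA⟩ := (Set.toFinite S).exists_minimal hne
  refine ⟨A, hA.prop, fun B hB => ?_⟩
  rcases (hF.laminar A (hS hA.prop) B (hS hB)).nested (hx A hA.prop) (hx B hB) with h | h
  exacts [h, hA.le_of_le hB h]

theorem exists_isLUB_pair (A B : F) : ∃ C : F, IsLUB {A, B} C := by
  obtain ⟨x, hx⟩ := hF.nonempty A A.2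
  obtain ⟨C, ⟨hC, hAC, hBC⟩, hmin⟩ := hF.exists_isLeast (S := {C | C ∈ F ∧ A.1 ⊆ C ∧ B.1 ⊆ C})
    (fun C hC => hC.1) ⟨Set.univ, hF.univ_mem, Set.subset_univ _, Set.subset_univ _⟩
    (fun C hC => hC.2.1 hx)
  refine ⟨⟨C, hC⟩, ?_, fun D hD => hmin ⟨D.2, hD (.inl rfl), hD (.inr rfl)⟩⟩
  rintro D (rfl | rfl)
  exacts [hAC, hBC]

theorem exists_succ (A : F) :
    ∃ C : F, A ≤ C ∧ (C ≤ A → IsMax A) ∧ ∀ D : F, A < D → C ≤ D := by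
  by_cases hA : IsMax A
  · exact ⟨A, le_rfl, fun _ => hA, fun D hD => hD.le⟩
  · obtain ⟨x, hx⟩ := hF.nonempty A A.2
    obtain ⟨D, hD⟩ := not_isMax_iff.1 hA
    obtain ⟨C, ⟨hC, hAC⟩, hmin⟩ := hF.exists_isLeast (S := {C | C ∈ F ∧ A.1 ⊂ C})
      (fun C hC => hC.1) ⟨D, D.2, hD⟩ (fun C hC => hC.2.1 hx)
    exact ⟨⟨C, hC⟩, hAC.1, fun h => absurd h hAC.2, fun D hD => hmin ⟨D.2, hD⟩⟩

end Order

section Tree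

variable {n : ℕ} {F : Set (Set (Fin n))} (hF : IsTreeFamily F)

/-- The rooted tree whose vertices are the members of the given family, ordered by reverse
inclusion. -/
noncomputable def rootedTree : RootedTree.{0} :=
  letI : SemilatticeSup F :=
    { sup := fun A B => (hF.exists_isLUB_pair A B).choose
      le_sup_left := fun A B => (hF.exists_isLUB_pair A B).choose_spec.1 (.inl rfl)
      le_sup_right := fun A B => (hF.exists_isLUB_pair A B).choose_spec.1 (.inr rfl)
      sup_le := fun A B _ hA hB => (hF.exists_isLUB_pair A B).choose_spec.2 (by
        rintro _ (rfl | rfl)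
        exacts [hA, hB]) }
  letI : OrderTop F :=
    { top := ⟨Set.univ, hF.univ_mem⟩
      le_top := fun A => Set.subset_univ A.1 }
  letI : SuccOrder F :=
    { succ := fun A => (hF.exists_succ A).choose
      le_succ := fun A => (hF.exists_succ A).choose_spec.1
      max_of_succ_le := fun {A} => (hF.exists_succ A).choose_spec.2.1
      succ_le_of_lt := fun {A B} => (hF.exists_succ A).choose_spec.2.2 B }
  { α := Fᵒᵈ }

instance : Finite hF.rootedTree := inferInstanceAs (Finite F)

/-- A member of the family as a vertex of its tree. -/
def node (A : Set (Fin n)) (hA : A ∈ F) : hF.rootedTree := OrderDual.toDual (⟨A, hA⟩ : F)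

/-- A vertex of the tree as a member of the family. -/
def set (v : hF.rootedTree) : Set (Fin n) := (OrderDual.ofDual v : F).1

theorem set_mem (v : hF.rootedTree) : hF.set v ∈ F := (OrderDual.ofDual v : F).2

theorem set_node (A : Set (Fin n)) (hA : A ∈ F) : hF.set (hF.node A hA) = A := rfl

theorem set_bot : hF.set ⊥ = Set.univ := rfl

theorem le_iff {u v : hF.rootedTree} : u ≤ v ↔ hF.set v ⊆ hF.set u := Iff.rfl

theorem lt_iff {u v : hF.rootedTree} : u < v ↔ hF.set v ⊂ hF.set u := Iff.rfl

theorem set_injective : Function.Injective hF.set := fun _ _ h =>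
  le_antisymm (hF.le_iff.2 h.ge) (hF.le_iff.2 h.le)

theorem isMax_iff {v : hF.rootedTree} : IsMax v ↔ ∃ i, hF.set v = {i} := by
  constructor
  · intro h
    obtain ⟨i, hi⟩ := hF.nonempty _ (hF.set_mem v)
    have hv : v = hF.node {i} (hF.singleton_mem i) :=
      h.eq_of_le (hF.le_iff.2 (Set.singleton_subset_iff.2 hi))
    exact ⟨i, by rw [hv, set_node]⟩
  · rintro ⟨i, hi⟩ w hw
    rw [le_iff, hi] at hw ⊢
    rw [(hF.nonempty _ (hF.set_mem w)).subset_singleton_iff.1 hw]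

theorem exists_covBy {v : hF.rootedTree} {i : Fin n} (hi : i ∈ hF.set v) (hv : ¬ IsMax v) :
    ∃ w, v ⋖ w ∧ i ∈ hF.set w := by
  have hlt : v < hF.node {i} (hF.singleton_mem i) := by
    refine lt_of_le_of_ne (hF.le_iff.2 (Set.singleton_subset_iff.2 hi)) ?_
    rintro rfl
    exact hv (hF.isMax_iff.2 ⟨i, rfl⟩)
  obtain ⟨w, hvw, hw⟩ := exists_covBy_le_of_lt hlt
  exact ⟨w, hvw, Set.singleton_subset_iff.1 (hF.le_iff.1 hw)⟩

/-- The labelled tree whose clusters are the members of the given family. -/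
noncomputable def labelledTree (hn : 2 ≤ n) : LabelledTree n where
  tree := hF.rootedTree
  finite := inferInstance
  leaf := Equiv.ofBijective
    (fun i => ⟨hF.node {i} (hF.singleton_mem i), hF.isMax_iff.2 ⟨i, rfl⟩⟩) <| by
      refine ⟨fun i j h => Set.singleton_injective (congrArg
        (fun v : {v : hF.rootedTree // IsMax v} => hF.set v.1) h), ?_⟩
      rintro ⟨v, hv⟩
      obtain ⟨i, hi⟩ := hF.isMax_iff.1 hv
      exact ⟨i, Subtype.ext (hF.set_injective hi.symm)⟩
  root_not_leaf := by
    have := Fin.nontrivial_iff_two_le.2 hn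
    rw [isMax_iff, set_bot]
    rintro ⟨i, hi⟩
    exact Set.nontrivial_univ.ne_singleton hi
  two_le_outdegree v hv := by
    obtain ⟨i, hi⟩ := hF.nonempty _ (hF.set_mem v)
    obtain ⟨a, ha, -⟩ := hF.exists_covBy hi hv
    obtain ⟨j, hj, hja⟩ := Set.exists_of_ssubset (hF.lt_iff.1 ha.lt)
    obtain ⟨b, hb, hjb⟩ := hF.exists_covBy hj hv
    exact (Set.one_lt_ncard (Set.toFinite _)).2 ⟨a, ha, b, hb, fun h => hja (h ▸ hjb)⟩

theorem cluster_labelledTree (hn : 2 ≤ n) (v : (hF.labelledTree hn).tree) :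
    (hF.labelledTree hn).cluster v = hF.set v :=
  Set.ext fun _ => Set.singleton_subset_iff

theorem edgeClusters_labelledTree (hn : 2 ≤ n) :
    (hF.labelledTree hn).edgeClusters = {A ∈ F | A ≠ Set.univ ∧ A.Nontrivial} := by
  ext A
  rw [LabelledTree.mem_edgeClusters]
  constructor
  · rintro ⟨hu, hA, v, rfl⟩
    refine ⟨?_, hu, hA⟩
    rw [cluster_labelledTree]
    exact hF.set_mem v
  · rintro ⟨hA, hu, hnt⟩
    exact ⟨hu, hnt, hF.node A hA, hF.cluster_labelledTree hn _⟩

end Tree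

end IsTreeFamily

/-- A family of proper subsets with at least `k` elements that are pairwise laminar. For `2 ≤ k ≤ n`
the maximal such families of subsets of `{1, …, n}` are the families of the clusters of the internal
edges of the trees that are binary except at preleaves, where they are `k`-ary. -/
structure IsNestedFamily {ι : Type*} (k : ℕ) (F : Set (Set ι)) : Prop where
  le_ncard : ∀ A ∈ F, k ≤ A.ncard
  univ_notMem : Set.univ ∉ F
  laminar : ∀ A ∈ F, ∀ B ∈ F, Laminar A B

namespace IsNestedFamily

variable {ι : Type*} {k : ℕ} {F M : Set (Set ι)} {A : Set ι}

theorem empty : IsNestedFamily k (∅ : Set (Set ι)) where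
  le_ncard _ h := h.elim
  univ_notMem h := h
  laminar _ h := h.elim

theorem mono (hM : IsNestedFamily k M) (h : F ⊆ M) : IsNestedFamily k F where
  le_ncard A hA := hM.le_ncard A (h hA)
  univ_notMem hu := hM.univ_notMem (h hu)
  laminar A hA B hB := hM.laminar A (h hA) B (h hB)

theorem insert (hF : IsNestedFamily k F) (hA : k ≤ A.ncard) (hu : A ≠ Set.univ)
    (hl : ∀ B ∈ F, Laminar A B) : IsNestedFamily k (insert A F) where
  le_ncard := by
    rintro B (rfl | hB)
    exacts [hA, hF.le_ncard B hB]
  univ_notMem := by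
    rintro (h | h)
    exacts [hu h.symm, hF.univ_notMem h]
  laminar := by
    rintro B (rfl | hB) C (rfl | hC)
    exacts [.refl _, hl C hC, (hl B hB).symm, hF.laminar B hB C hC]

theorem singleton (hA : k ≤ A.ncard) (hu : A ≠ Set.univ) : IsNestedFamily k {A} := by
  rw [← insert_empty_eq A]
  exact empty.insert hA hu fun _ h => h.elim

theorem nontrivial (hF : IsNestedFamily k F) (hk : 2 ≤ k) (hA : A ∈ F) : A.Nontrivial :=
  (Set.one_lt_ncard_iff_nontrivial_and_finite.1 (hk.trans (hF.le_ncard A hA))).1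

end IsNestedFamily

namespace LabelledTree

variable {n k : ℕ} {T : LabelledTree n} {u v a b : T.tree}

theorem exists_edgeClusters_eq {F : Set (Set (Fin n))} (hn : 2 ≤ n) (hk : 2 ≤ k)
    (hF : IsNestedFamily k F) : ∃ T : LabelledTree n, T.edgeClusters = F := by
  have : Nonempty (Fin n) := ⟨⟨0, by omega⟩⟩
  have hM := IsTreeFamily.of_laminar (fun A hA => (hF.nontrivial hk hA).nonempty) hF.laminar
  refine ⟨hM.labelledTree hn, ?_⟩
  rw [hM.edgeClusters_labelledTree hn]
  ext A
  refine ⟨?_, fun hA => ⟨.inl hA, fun h => hF.univ_notMem (h ▸ hA), hF.nontrivial hk hA⟩⟩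
  rintro ⟨hA | rfl | ⟨x, rfl⟩, hu, hnt⟩
  exacts [hA, absurd rfl hu, absurd hnt Set.not_nontrivial_singleton]

theorem IsPreleaf.isMax_of_lt (hu : T.IsPreleaf u) (h : u < v) : IsMax v :=
  not_not.1 (hu.not_prop_of_gt h)

theorem IsPreleaf.setOf_covBy (hu : T.IsPreleaf u) :
    {w : T.tree | u ⋖ w} = (fun i => (T.leaf i : T.tree)) '' T.cluster u := by
  ext w
  constructor
  · intro hw
    obtain ⟨i, rfl⟩ := exists_leaf_eq (hu.isMax_of_lt hw.lt)
    exact ⟨i, hw.le, rfl⟩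
  · rintro ⟨i, hi, rfl⟩
    refine ⟨lt_of_le_of_ne hi fun h => hu.prop (h ▸ isMax_leaf i), fun x hux hxi => ?_⟩
    exact (hu.isMax_of_lt hux).not_lt hxi

theorem IsPreleaf.ncard_covBy (hu : T.IsPreleaf u) :
    {w : T.tree | u ⋖ w}.ncard = (T.cluster u).ncard := by
  rw [hu.setOf_covBy, Set.ncard_image_of_injective _ leaf_injective]

theorem IsKEqual.le_ncard_cluster (hT : T.IsKEqual k) (hv : ¬ IsMax v) :
    k ≤ (T.cluster v).ncard := by
  obtain ⟨u, hvu, hu⟩ := (Set.toFinite {w : T.tree | ¬ IsMax w}).exists_le_maximal hv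
  have hpre : T.IsPreleaf u := hu
  rw [← (hT u hpre.prop).1 hpre, hpre.ncard_covBy]
  exact Set.ncard_le_ncard (cluster_anti hvu) (Set.toFinite _)

theorem IsKEqual.isNestedFamily_edgeClusters (hT : T.IsKEqual k) :
    IsNestedFamily k T.edgeClusters where
  le_ncard := by
    rintro _ ⟨v, hv, rfl⟩
    exact hT.le_ncard_cluster hv.2
  univ_notMem h := (mem_edgeClusters.1 h).1 rfl
  laminar := by
    rintro _ ⟨u, -, rfl⟩ _ ⟨v, -, rfl⟩
    exact laminar_cluster u v

theorem IsPreleaf.laminar_of_subset_cluster {C : Set (Fin n)} (hu : T.IsPreleaf u)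
    (hC : C ⊆ T.cluster u) (v : T.tree) : Laminar C (T.cluster v) := by
  rcases laminar_cluster u v with h | h | h
  · exact .inl (hC.trans h)
  · rcases (cluster_subset_iff.1 h).eq_or_lt with rfl | huv
    · exact .inl hC
    · obtain ⟨i, rfl⟩ := exists_leaf_eq (hu.isMax_of_lt huv)
      rw [cluster_leaf]
      exact (Laminar.singleton_left i C).symm
  · exact .inr (.inr (h.mono_left hC))

theorem subset_or_subset_or_disjoint_of_covBy (ha : u ⋖ a) (v : T.tree) :
    T.cluster u ⊆ T.cluster v ∨ T.cluster v ⊆ T.cluster a ∨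
      Disjoint (T.cluster a) (T.cluster v) := by
  rcases laminar_cluster a v with h | h | h
  · rcases (cluster_subset_iff.1 h).eq_or_lt with rfl | hva
    · exact .inr (.inl subset_rfl)
    · obtain ⟨i, hi⟩ := cluster_nonempty a
      rcases le_total_of_mem_cluster (cluster_anti ha.le hi) (h hi) with huv | hvu
      · rcases ha.eq_or_eq huv hva.le with rfl | rfl
        exacts [.inl subset_rfl, (hva.false).elim]
      · exact .inl (cluster_anti hvu)
  · exact .inr (.inl h)
  · exact .inr (.inr h)

theorem laminar_union_of_covBy (ha : u ⋖ a) (hb : u ⋖ b) (v : T.tree) :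
    Laminar (T.cluster a ∪ T.cluster b) (T.cluster v) := by
  have hsub : T.cluster a ∪ T.cluster b ⊆ T.cluster u :=
    Set.union_subset (cluster_anti ha.le) (cluster_anti hb.le)
  rcases subset_or_subset_or_disjoint_of_covBy ha v with hv | hv | hav
  · exact .inl (hsub.trans hv)
  · exact .inr (.inl (hv.trans Set.subset_union_left))
  rcases subset_or_subset_or_disjoint_of_covBy hb v with hv | hv | hbv
  · exact .inl (hsub.trans hv)
  · exact .inr (.inl (hv.trans Set.subset_union_right))
  · exact .inr (.inr (Set.disjoint_union_left.2 ⟨hav, hbv⟩))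

theorem setOf_covBy_eq_pair (ha : u ⋖ a) (hb : u ⋖ b)
    (hu : T.cluster u ⊆ T.cluster a ∪ T.cluster b) : {w : T.tree | u ⋖ w} = {a, b} := by
  refine Set.Subset.antisymm (fun c hc => ?_) (Set.pair_subset ha hb)
  have eq_of_mem : ∀ {d : T.tree} {i : Fin n}, u ⋖ d → i ∈ T.cluster c → i ∈ T.cluster d → c = d :=
    fun hd hic hid => by
      by_contra hcd
      exact Set.disjoint_left.1 (disjoint_cluster_of_covBy hc hd hcd) hic hid
  obtain ⟨i, hi⟩ := cluster_nonempty c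
  rcases hu (cluster_anti hc.le hi) with h | h
  exacts [.inl (eq_of_mem ha hi h), .inr (eq_of_mem hb hi h)]

section Maximal

variable (hT : ∀ C : Set (Fin n), k ≤ C.ncard → (∀ v, Laminar C (T.cluster v)) →
  ∃ v, T.cluster v = C)
include hT

theorem IsPreleaf.ncard_covBy_of_maximal (hk : 2 ≤ k) (hu : T.IsPreleaf u)
    (hcard : k ≤ (T.cluster u).ncard) : {w : T.tree | u ⋖ w}.ncard = k := by
  obtain ⟨C, hCu, hC⟩ := Set.exists_subset_card_eq hcard
  obtain ⟨v, rfl⟩ := hT C hC.ge (hu.laminar_of_subset_cluster hCu)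
  rcases (cluster_subset_iff.1 hCu).eq_or_lt with rfl | huv
  · rw [hu.ncard_covBy, hC]
  · obtain ⟨i, rfl⟩ := exists_leaf_eq (hu.isMax_of_lt huv)
    rw [cluster_leaf, Set.ncard_singleton] at hC
    omega

theorem ncard_covBy_of_not_isPreleaf (hu : ¬ IsMax u) (hpre : ¬ T.IsPreleaf u)
    (hcard : ∀ v : T.tree, ¬ IsMax v → k ≤ (T.cluster v).ncard) :
    {w : T.tree | u ⋖ w}.ncard = 2 := by
  obtain ⟨v, huv, hv⟩ := exists_gt_of_not_maximal (P := fun w : T.tree => ¬ IsMax w) hu hpre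
  obtain ⟨a, ha, hav⟩ := exists_covBy_le_of_lt huv
  have hamax : ¬ IsMax a := fun h => hv (h.mono hav)
  obtain ⟨b, hb, hba⟩ := Set.exists_ne_of_one_lt_ncard (T.two_le_outdegree u hu) a
  obtain ⟨w, hw⟩ := hT (T.cluster a ∪ T.cluster b)
    ((hcard a hamax).trans (Set.ncard_le_ncard Set.subset_union_left (Set.toFinite _)))
    (laminar_union_of_covBy ha hb)
  have huw : u ≤ w := by
    rw [← cluster_subset_iff, hw]
    exact Set.union_subset (cluster_anti ha.le) (cluster_anti hb.le)
  have hwa : w ≤ a := by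
    rw [← cluster_subset_iff, hw]
    exact Set.subset_union_left
  have hwb : w ≤ b := by
    rw [← cluster_subset_iff, hw]
    exact Set.subset_union_right
  have hwu : w = u := (ha.eq_or_eq huw hwa).resolve_right fun h =>
    hba (((hb.eq_or_eq ha.le (h ▸ hwb)).resolve_left ha.ne').symm)
  rw [setOf_covBy_eq_pair ha hb (hwu ▸ hw).le, Set.ncard_pair hba.symm]

theorem isKEqual_of_maximal (hk : 2 ≤ k)
    (hcard : ∀ v : T.tree, ¬ IsMax v → k ≤ (T.cluster v).ncard) : T.IsKEqual k := fun u hu =>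
  ⟨fun hpre => hpre.ncard_covBy_of_maximal hT hk (hcard u hu),
    fun hpre => ncard_covBy_of_not_isPreleaf hT hu hpre hcard⟩

end Maximal

theorem isKEqual_of_maximal_edgeClusters (hk : 2 ≤ k) (hkn : k ≤ n)
    (hT : Maximal (IsNestedFamily k) T.edgeClusters) : T.IsKEqual k := by
  refine isKEqual_of_maximal (fun C hC hl => ?_) hk fun v hv => ?_
  · by_cases hu : C = Set.univ
    · exact ⟨⊥, by rw [hu, cluster_bot]⟩
    · have hins : IsNestedFamily k (insert C T.edgeClusters) := by
        refine hT.prop.insert hC hu ?_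
        rintro _ ⟨v, -, rfl⟩
        exact hl v
      exact (mem_edgeClusters.1 (hT.mem_of_prop_insert hins)).2.2
  · rcases eq_or_ne v ⊥ with rfl | hb
    · rwa [cluster_bot, Set.ncard_univ, Nat.card_fin]
    · exact hT.prop.le_ncard _ ⟨v, ⟨hb, hv⟩, rfl⟩

theorem exists_isKEqual_iff (hk : 2 ≤ k) (hkn : k ≤ n) {F : Set (Set (Fin n))} :
    (∃ T : LabelledTree n, T.IsKEqual k ∧ F ⊆ T.edgeClusters) ↔ IsNestedFamily k F := by
  refine ⟨fun ⟨T, hT, hF⟩ => hT.isNestedFamily_edgeClusters.mono hF, fun hF => ?_⟩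
  obtain ⟨M, hFM, hM⟩ := (Set.toFinite {M | IsNestedFamily k M}).exists_le_maximal hF
  obtain ⟨T, rfl⟩ := exists_edgeClusters_eq (hk.trans hkn) hk hM.prop
  exact ⟨T, isKEqual_of_maximal_edgeClusters hk hkn hM, hFM⟩

end LabelledTree

open LabelledTree

namespace TreeType

variable {n : ℕ}

/-- The clusters of the internal edges of a combinatorial type of trees. -/
def edgeClusters (c : TreeType n) : Set (Set (Fin n)) :=
  Quotient.lift LabelledTree.edgeClusters (fun _ _ => SameType.edgeClusters_eq) c

theorem edgeClusters_mk (T : LabelledTree n) :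
    edgeClusters (Quotient.mk _ T) = T.edgeClusters := rfl

theorem edgeClusters_smul (σ : Equiv.Perm (Fin n)) (c : TreeType n) :
    edgeClusters (σ • c) = Set.image σ '' edgeClusters c := by
  induction c using Quotient.inductionOn with
  | h T => exact edgeClusters_relabel σ T

theorem mem_simplex_iff {T : LabelledTree n} {c : TreeType n} :
    c ∈ simplex T ↔ (edgeClusters c).ncard = 1 ∧ edgeClusters c ⊆ T.edgeClusters := by
  constructor
  · rintro ⟨S, rfl, hS, hTS⟩
    rw [edgeClusters_mk, ncard_edgeClusters]
    exact ⟨hS, contractsTo_iff_edgeClusters_subset.1 hTS⟩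
  · induction c using Quotient.inductionOn with
    | h S =>
      rintro ⟨hS, hTS⟩
      rw [edgeClusters_mk, ncard_edgeClusters] at hS
      exact ⟨S, rfl, hS, contractsTo_iff_edgeClusters_subset.2 hTS⟩

end TreeType

theorem nonempty_treeType {n : ℕ} (hn : 2 ≤ n) : Nonempty (TreeType n) := by
  obtain ⟨T, -⟩ := exists_edgeClusters_eq hn le_rfl .empty
  exact ⟨Quotient.mk _ T⟩

theorem isSimplex_kEqualTreeComplex_iff {n k : ℕ} (hk : 2 ≤ k) (hkn : k ≤ n)
    {C : Set (TreeType n)} :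
    SimplicialHomology.IsSimplex (kEqualTreeComplex n k) C ↔
      C.Finite ∧ (∀ c ∈ C, c.edgeClusters.ncard = 1) ∧
        IsNestedFamily k (⋃ c ∈ C, c.edgeClusters) := by
  constructor
  · rintro (rfl | ⟨s, ⟨-, T, hT, hs⟩, rfl⟩)
    · simpa using IsNestedFamily.empty
    · have hsT : ∀ c ∈ (s : Set (TreeType n)), _ := fun c hc => TreeType.mem_simplex_iff.1 (hs hc)
      exact ⟨s.finite_toSet, fun c hc => (hsT c hc).1,
        hT.isNestedFamily_edgeClusters.mono (Set.iUnion₂_subset fun c hc => (hsT c hc).2)⟩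
  · rintro ⟨hfin, hC, hF⟩
    obtain ⟨T, hT, hCT⟩ := (exists_isKEqual_iff hk hkn).2 hF
    lift C to Finset (TreeType n) using hfin
    rcases C.eq_empty_or_nonempty with rfl | hne
    · exact .inl Finset.coe_empty
    · exact .inr ⟨C, ⟨hne, T, hT, fun c hc => TreeType.mem_simplex_iff.2
        ⟨hC c hc, (Set.subset_biUnion_of_mem hc).trans hCT⟩⟩, rfl⟩

end KEqualTree

/-! ### Partitions associated with trees -/

namespace KEqualLattice

open KEqualTree SimplicialHomology

section Block

variable {ι : Type*} {A B : Set ι} {F : Set (Set ι)} {π : Setoid ι} {x y : ι}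

/-- The set partition in which `A` is a block, unless it is empty, and all other blocks are
singletons. -/
def block (A : Set ι) : Setoid ι where
  r x y := x = y ∨ (x ∈ A ∧ y ∈ A)
  iseqv :=
    { refl := fun _ => .inl rfl
      symm := by
        rintro x y (rfl | ⟨hx, hy⟩)
        exacts [.inl rfl, .inr ⟨hy, hx⟩]
      trans := by
        rintro x y z (rfl | ⟨hx, hy⟩) (rfl | ⟨hy', hz⟩)
        exacts [.inl rfl, .inr ⟨hy', hz⟩, .inr ⟨hx, hy⟩, .inr ⟨hx, hz⟩] }

theorem block_rel : block A x y ↔ x = y ∨ (x ∈ A ∧ y ∈ A) := Iff.rfl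

theorem block_le_iff : block A ≤ π ↔ ∀ x ∈ A, ∀ y ∈ A, π x y := by
  refine ⟨fun h x hx y hy => h (.inr ⟨hx, hy⟩), ?_⟩
  rintro h x y (rfl | ⟨hx, hy⟩)
  exacts [π.refl x, h x hx y hy]

theorem block_mono (h : A ⊆ B) : block A ≤ block B :=
  block_le_iff.2 fun _ hx _ hy => .inr ⟨h hx, h hy⟩

theorem sSup_block_rel_iff (hF : ∀ A ∈ F, ∀ B ∈ F, Laminar A B) :
    sSup (block '' F) x y ↔ x = y ∨ ∃ A ∈ F, x ∈ A ∧ y ∈ A := by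
  let r : Setoid ι :=
    { r := fun x y => x = y ∨ ∃ A ∈ F, x ∈ A ∧ y ∈ A
      iseqv :=
        { refl := fun _ => .inl rfl
          symm := by
            rintro x y (rfl | ⟨A, hA, hx, hy⟩)
            exacts [.inl rfl, .inr ⟨A, hA, hy, hx⟩]
          trans := by
            rintro x y z (rfl | ⟨A, hA, hx, hy⟩) (rfl | ⟨B, hB, hy', hz⟩)
            · exact .inl rfl
            · exact .inr ⟨B, hB, hy', hz⟩
            · exact .inr ⟨A, hA, hx, hy⟩
            · rcases (hF A hA B hB).nested hy hy' with h | h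
              exacts [.inr ⟨B, hB, h hx, hz⟩, .inr ⟨A, hA, hx, h hz⟩] } }
  have hr : sSup (block '' F) ≤ r := by
    refine sSup_le ?_
    rintro _ ⟨A, hA, rfl⟩
    exact block_le_iff.2 fun x hx y hy => .inr ⟨A, hA, hx, hy⟩
  refine ⟨fun h => hr h, ?_⟩
  rintro (rfl | ⟨A, hA, hx, hy⟩)
  · exact Setoid.refl' _ _
  · exact block_le_iff.1 (le_sSup (Set.mem_image_of_mem block hA)) x hx y hy

theorem sSup_block_ne_top [Finite ι] (hne : F.Nonempty) (hF : ∀ A ∈ F, ∀ B ∈ F, Laminar A B)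
    (hF_ne : ∀ A ∈ F, A.Nonempty) (hu : Set.univ ∉ F) : sSup (block '' F) ≠ ⊤ := by
  intro htop
  obtain ⟨A, hA⟩ := (Set.toFinite F).exists_maximal hne
  obtain ⟨x, hx⟩ := hF_ne A hA.prop
  obtain ⟨y, hy⟩ := (Set.ne_univ_iff_exists_notMem A).1 fun h => hu (h ▸ hA.prop)
  have hxy : sSup (block '' F) x y := htop ▸ trivial
  rcases (sSup_block_rel_iff hF).1 hxy with rfl | ⟨B, hB, hxB, hyB⟩
  · exact hy hx
  · rcases (hF A hA.prop B hB).nested hx hxB with h | h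
    exacts [hy (hA.le_of_ge hB h hyB), hy (h hyB)]

theorem block_le_of_mem_classes (hA : A ∈ π.classes) : block A ≤ π := by
  obtain ⟨z, rfl⟩ := hA
  exact block_le_iff.2 fun x hx y hy => π.trans hx (π.symm hy)

theorem laminar_of_mem_classes (hA : A ∈ π.classes) (hB : block B ≤ π) : Laminar A B := by
  by_cases hd : Disjoint A B
  · exact .inr (.inr hd)
  · obtain ⟨y, hyA, hyB⟩ := Set.not_disjoint_iff.1 hd
    obtain ⟨x, rfl⟩ := hA
    exact .inr (.inl fun z hz => π.trans (block_le_iff.1 hB z hz y hyB) hyA)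

end Block

section ProperPart

variable {n k : ℕ} {π : Setoid (Fin n)} {F : Set (Set (Fin n))}

theorem smul_block (σ : Equiv.Perm (Fin n)) (A : Set (Fin n)) : σ • block A = block (σ '' A) := by
  ext x y
  rw [smul_rel, block_rel, block_rel, Set.mem_image_equiv, Set.mem_image_equiv,
    EmbeddingLike.apply_eq_iff_eq]
  rfl

theorem isSingleBlock_iff : IsSingleBlock k π ↔ ∃ A : Set (Fin n), A.ncard = k ∧ π = block A := by
  constructor
  · rintro ⟨B, hB, h⟩
    refine ⟨B, by rwa [Set.ncard_coe_finset], Setoid.ext fun x y => ?_⟩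
    rw [h, block_rel, Finset.mem_coe, Finset.mem_coe]
  · rintro ⟨A, hA, rfl⟩
    lift A to Finset (Fin n) using Set.toFinite A
    exact ⟨A, by rwa [← Set.ncard_coe_finset], fun x y => Iff.rfl⟩

theorem sSup_block_mem_kEqualLattice (hk : 2 ≤ k) (hF : ∀ A ∈ F, k ≤ A.ncard) :
    sSup (block '' F) ∈ kEqualLattice n k := by
  let S : Set (Setoid (Fin n)) := {ρ | IsSingleBlock k ρ ∧ ρ ≤ sSup (block '' F)}
  refine ⟨S, fun ρ hρ => hρ.1, le_antisymm (sSup_le fun ρ hρ => hρ.2) (sSup_le ?_)⟩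
  rintro _ ⟨A, hA, rfl⟩
  refine block_le_iff.2 fun x hx y hy => ?_
  have hxy_card : ({x, y} : Set (Fin n)).ncard ≤ k :=
    (Set.ncard_insert_le x {y}).trans (by rwa [Set.ncard_singleton])
  obtain ⟨C, hxyC, hCA, hC⟩ := Set.exists_subsuperset_card_eq (Set.pair_subset hx hy) hxy_card
    (hF A hA)
  have hCS : block C ∈ S := ⟨isSingleBlock_iff.2 ⟨C, hC, rfl⟩,
    (block_mono hCA).trans (le_sSup (Set.mem_image_of_mem block hA))⟩
  exact block_le_iff.1 (le_sSup hCS) x (hxyC (.inl rfl)) y (hxyC (.inr rfl))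

theorem sSup_block_mem_properPart (hk : 2 ≤ k) (hne : F.Nonempty) (hF : IsNestedFamily k F) :
    sSup (block '' F) ∈ properPart n k := by
  refine ⟨sSup_block_mem_kEqualLattice hk hF.le_ncard, fun hbot => ?_,
    sSup_block_ne_top hne hF.laminar (fun A hA => (hF.nontrivial hk hA).nonempty) hF.univ_notMem⟩
  obtain ⟨A, hA⟩ := hne
  obtain ⟨x, hx, y, hy, hxy⟩ := hF.nontrivial hk hA
  exact hxy (block_le_iff.1 (hbot ▸ le_sSup (Set.mem_image_of_mem block hA)) x hx y hy)

theorem exists_mem_classes_of_mem_properPart (hπ : π ∈ properPart n k) :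
    ∃ A ∈ π.classes, k ≤ A.ncard ∧ A ≠ Set.univ := by
  obtain ⟨⟨S, hS, rfl⟩, hbot, htop⟩ := hπ
  obtain ⟨ρ, hρ, hρ_bot⟩ : ∃ ρ ∈ S, ρ ≠ ⊥ := by
    by_contra! h
    exact hbot (le_bot_iff.1 (sSup_le fun ρ hρ => (h ρ hρ).le))
  obtain ⟨B, rfl, rfl⟩ := isSingleBlock_iff.1 (hS ρ hρ)
  obtain ⟨x, hx⟩ : B.Nonempty := by
    by_contra! h
    exact hρ_bot (le_bot_iff.1 (block_le_iff.2 fun x hx => by simp [h] at hx))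
  have hB := block_le_iff.1 (le_sSup hρ)
  refine ⟨_, Setoid.mem_classes (sSup S) x,
    Set.ncard_le_ncard (fun y hy => hB y hy x hx) (Set.toFinite _), fun h => htop ?_⟩
  have hle := block_le_of_mem_classes (h ▸ Setoid.mem_classes (sSup S) x)
  exact top_le_iff.1 fun y z _ => block_le_iff.1 hle y trivial z trivial

end ProperPart

section Partition

variable {n k : ℕ} {π : Setoid (Fin n)} {c : TreeType n}

/-- The set partition associated with a combinatorial type of trees: the join of the partitions
with a single nontrivial block that are given by the clusters of its internal edges. -/
def partition (c : TreeType n) : Setoid (Fin n) := sSup (block '' c.edgeClusters)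

theorem partition_le_iff : partition c ≤ π ↔ ∀ A ∈ c.edgeClusters, block A ≤ π := by
  rw [partition, sSup_le_iff, Set.forall_mem_image]

theorem partition_smul (σ : Equiv.Perm (Fin n)) (c : TreeType n) :
    partition (σ • c) = σ • partition c := by
  refine eq_of_forall_ge_iff fun π => ?_
  rw [smul_le_iff, partition_le_iff, partition_le_iff, TreeType.edgeClusters_smul,
    Set.forall_mem_image]
  refine forall₂_congr fun A _ => ?_
  rw [← smul_block, smul_le_iff]

theorem isLUB_partition (C : Set (TreeType n)) :
    IsLUB (partition '' C) (sSup (block '' ⋃ c ∈ C, c.edgeClusters)) := by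
  refine ⟨?_, fun π hπ => sSup_le ?_⟩
  · rintro _ ⟨c, hc, rfl⟩
    exact partition_le_iff.2 fun A hA =>
      le_sSup (Set.mem_image_of_mem block (Set.mem_biUnion hc hA))
  · rintro _ ⟨A, hA, rfl⟩
    obtain ⟨c, hc, hA⟩ := Set.mem_iUnion₂.1 hA
    exact partition_le_iff.1 (hπ (Set.mem_image_of_mem partition hc)) A hA

theorem isApex_sublevel_partition (hk : 2 ≤ k) (hkn : k ≤ n) {A : Set (Fin n)}
    (hA : A ∈ π.classes) (hAk : k ≤ A.ncard) (hu : A ≠ Set.univ) (hc : c.edgeClusters = {A}) :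
    IsApex (sublevel (kEqualTreeComplex n k) partition π) c := by
  intro C hC
  rw [isSimplex_sublevel_iff, isSimplex_kEqualTreeComplex_iff hk hkn] at hC ⊢
  obtain ⟨⟨hfin, hC_ncard, hF⟩, hCπ⟩ := hC
  have hcπ : partition c ≤ π := by
    rw [partition_le_iff, hc]
    rintro _ rfl
    exact block_le_of_mem_classes hA
  refine ⟨⟨hfin.insert c, ?_, ?_⟩, Set.forall_mem_insert.2 ⟨hcπ, hCπ⟩⟩
  · exact Set.forall_mem_insert.2 ⟨by rw [hc, Set.ncard_singleton], hC_ncard⟩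
  · rw [Set.biUnion_insert, hc, Set.singleton_union]
    refine hF.insert hAk hu fun B hB => ?_
    obtain ⟨b, hb, hB⟩ := Set.mem_iUnion₂.1 hB
    exact laminar_of_mem_classes hA (partition_le_iff.1 (hCπ b hb) B hB)

theorem hasConeFibers_kEqualTreeComplex (hk : 2 ≤ k) (hkn : k ≤ n) :
    HasConeFibers (kEqualTreeComplex n k) partition (properPart n k) where
  exists_isLUB C hC hne := by
    obtain ⟨-, hC_ncard, hF⟩ := (isSimplex_kEqualTreeComplex_iff hk hkn).1 hC
    obtain ⟨c, hc⟩ := hne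
    obtain ⟨A, hA⟩ := Set.ncard_eq_one.1 (hC_ncard c hc)
    have hAF : A ∈ ⋃ c ∈ C, c.edgeClusters := Set.mem_biUnion hc (hA ▸ rfl)
    exact ⟨_, sSup_block_mem_properPart hk ⟨A, hAF⟩ hF, isLUB_partition C⟩
  exists_isApex π hπ := by
    obtain ⟨A, hA, hAk, hu⟩ := exists_mem_classes_of_mem_properPart hπ
    obtain ⟨T, hT⟩ := LabelledTree.exists_edgeClusters_eq (hk.trans hkn) hk
      (IsNestedFamily.singleton hAk hu)
    exact ⟨Quotient.mk _ T, isApex_sublevel_partition hk hkn hA hAk hu hT⟩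

end Partition

section OrderComplex

variable {P : Type*} [PartialOrder P] {S : Set P}

theorem isSimplex_orderComplex_iff {s : Set P} :
    IsSimplex (orderComplex S) s ↔ s.Finite ∧ s ⊆ S ∧ IsChain (· ≤ ·) s := by
  constructor
  · rintro (rfl | ⟨t, ⟨-, htS, ht⟩, rfl⟩)
    exacts [⟨Set.finite_empty, Set.empty_subset S, .empty⟩, ⟨t.finite_toSet, htS, ht⟩]
  · rintro ⟨hfin, hsS, hs⟩
    lift s to Finset P using hfin
    rcases s.eq_empty_or_nonempty with rfl | hne
    exacts [.inl Finset.coe_empty, .inr ⟨s, ⟨hne, hsS, hs⟩, rfl⟩]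

theorem hasConeFibers_orderComplex (S : Set P) : HasConeFibers (orderComplex S) id S where
  exists_isLUB s hs hne := by
    obtain ⟨hfin, hsS, hchain⟩ := isSimplex_orderComplex_iff.1 hs
    obtain ⟨m, hm⟩ := hfin.exists_maximal hne
    have hgreatest : IsGreatest s m :=
      ⟨hm.prop, fun p hp => (hchain.total hp hm.prop).elim id fun h => hm.le_of_ge hp h⟩
    rw [Set.image_id]
    exact ⟨m, hsS hm.prop, hgreatest.isLUB⟩
  exists_isApex q hq := by
    refine ⟨q, fun s hs => ?_⟩
    rw [isSimplex_sublevel_iff, isSimplex_orderComplex_iff] at hs ⊢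
    obtain ⟨⟨hfin, hsS, hchain⟩, hsq⟩ := hs
    exact ⟨⟨hfin.insert q, Set.insert_subset hq hsS, hchain.insert fun p hp _ => .inr (hsq p hp)⟩,
      Set.forall_mem_insert.2 ⟨le_rfl, hsq⟩⟩

end OrderComplex

end KEqualLattice

theorem mainTheorem8 (R : Type*) [CommRing R] (n k : ℕ) (hk : 2 ≤ k) (hkn : k < n) :
    ∀ d : ℕ, Nonempty
      ((SimplicialHomology.reducedHomologyRep R (KEqualTree.kEqualTreeComplex n k)
          (KEqualTree.kEqualTreeComplex_isInvariant n k) d).Equiv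
        (SimplicialHomology.reducedHomologyRep R
          (KEqualLattice.orderComplex (KEqualLattice.properPart n k))
          (KEqualLattice.orderComplex_isInvariant n k) d)) := by
  intro d
  have hn : 2 ≤ n := hk.trans hkn.le
  have := KEqualTree.nonempty_treeType hn
  exact SimplicialHomology.nonempty_reducedHomologyRep_equiv
    (fun σ _ _ h => KEqualLattice.smul_mono σ h) KEqualLattice.partition_smul (fun _ _ => rfl)
    (KEqualTree.kEqualTreeComplex_isInvariant n k) (KEqualLattice.orderComplex_isInvariant n k)
    (KEqualLattice.hasConeFibers_kEqualTreeComplex hk hkn.le)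
    (KEqualLattice.hasConeFibers_orderComplex (KEqualLattice.properPart n k)) d
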